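/- Let $\ell>2$ be a prime number. For an integer $s\ge 0$ let $\mathcal{B}_\ell(s)=\{x\in \mathrm{SL}_2(\mathbb{Z}_\ell) : x\equiv \mathrm{Id} \pmod{\ell^s}\}$, and put $\mathcal{B}_\ell(s,t)=\mathcal{B}_\ell(s)\times\mathcal{B}_\ell(t)\subseteq \mathrm{SL}_2(\mathbb{Z}_\ell)^2$. For an open subgroup $T$ of $\mathrm{SL}_2(\mathbb{Z}_\ell)^2$ let $T'$ be its derived (commutator) subgroup, and let $\mathcal{L}(T)\subseteq \mathfrak{sl}_2(\mathbb{Z}_\ell)\oplus\mathfrak{sl}_2(\mathbb{Z}_\ell)$ be the $\mathbb{Z}_\ell$-span of the elements $\left(t_1-\tfrac12\operatorname{tr}(t_1)\,\mathrm{Id},\ t_2-\tfrac12\operatorname{tr}(t_2)\,\mathrm{Id}\right)$ for $(t_1,t_2)\in T$. For $x\in\mathrm{SL}_2(\mathbb{Z}_\ell)$ write $[x]$ for its reduction in $\mathrm{SL}_2(\mathbb{F}_\ell)$. Let $G$ be an open subgroup of $\mathrm{SL}_2(\mathbb{Z}_\ell)^2$ with projections $G_1,G_2$ on the two factors, and for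 $i=1,2$ let $n_i$ be a positive integer such that $G_i\supseteq\mathcal{B}_\ell(n_i)$. Then at least one of the following holds: 1. $G'$ contains $\mathcal{B}_\ell(20\max\{n_1,n_2\},\,20\max\{n_1,n_2\})$; 2. there exists an open subgroup $T$ of $G$, of index dividing $48^2$, with the following two properties: (a) for every integer $k\ge 0$, if $\mathcal{L}(T)$ contains $\ell^k\mathfrak{sl}_2(\mathbb{Z}_\ell)\oplus\ell^k\mathfrak{sl}_2(\mathbb{Z}_\ell)$, then $T'$ contains $\mathcal{B}_\ell(p,p)$, where $p=2k+\max\{2k,8n_1,8n_2\}$; (b) for every $(t_1,t_2)\in T$, if both $[t_1]$ and $[t_2]$ are multiples of the identity, then $[t_1]=[t_2]$. -/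

import Mathlib

open scoped MatrixGroups Pointwise

namespace PinkSL2

/-- `𝓑_ℓ(s)`: the matrices of `SL₂(ℤ_ℓ)` congruent to the identity modulo `ℓ ^ s`.
For `s = 0` this is all of `SL₂(ℤ_ℓ)`. -/
noncomputable def ball (ℓ : ℕ) [Fact ℓ.Prime] (s : ℕ) : Subgroup SL(2, ℤ_[ℓ]) :=
  (Matrix.SpecialLinearGroup.map (n := Fin 2) (PadicInt.toZModPow (p := ℓ) s)).ker

/-- `𝓑_ℓ(s₁, s₂) = 𝓑_ℓ(s₁) × 𝓑_ℓ(s₂)`. -/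
noncomputable def ball₂ (ℓ : ℕ) [Fact ℓ.Prime] (s₁ s₂ : ℕ) : Subgroup (SL(2, ℤ_[ℓ]) × SL(2, ℤ_[ℓ])) :=
  (ball ℓ s₁).prod (ball ℓ s₂)

/-- `Θ₁(g) = g - (1/2) tr(g) · Id`. For odd `ℓ` the element `2` is a unit of `ℤ_ℓ` and
`Ring.inverse 2` is its inverse. -/
noncomputable def theta₁ (ℓ : ℕ) [Fact ℓ.Prime] (g : SL(2, ℤ_[ℓ])) :
    Matrix (Fin 2) (Fin 2) ℤ_[ℓ] :=
  (g : Matrix (Fin 2) (Fin 2) ℤ_[ℓ]) -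
    (Ring.inverse (2 : ℤ_[ℓ]) * (g : Matrix (Fin 2) (Fin 2) ℤ_[ℓ]).trace) • 1

/-- `Θ₂(g₁, g₂) = (Θ₁(g₁), Θ₁(g₂))`. -/
noncomputable def theta₂ (ℓ : ℕ) [Fact ℓ.Prime] (g : SL(2, ℤ_[ℓ]) × SL(2, ℤ_[ℓ])) :
    Matrix (Fin 2) (Fin 2) ℤ_[ℓ] × Matrix (Fin 2) (Fin 2) ℤ_[ℓ] :=
  (theta₁ ℓ g.1, theta₁ ℓ g.2)

/-- `𝓛(T)`: the `ℤ_ℓ`-span of `Θ₂(T)`. -/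
noncomputable def lieAlg (ℓ : ℕ) [Fact ℓ.Prime] (T : Subgroup (SL(2, ℤ_[ℓ]) × SL(2, ℤ_[ℓ]))) :
    Submodule ℤ_[ℓ] (Matrix (Fin 2) (Fin 2) ℤ_[ℓ] × Matrix (Fin 2) (Fin 2) ℤ_[ℓ]) :=
  Submodule.span ℤ_[ℓ] (theta₂ ℓ '' (T : Set (SL(2, ℤ_[ℓ]) × SL(2, ℤ_[ℓ]))))

/-- `ℓ ^ k 𝔰𝔩₂(ℤ_ℓ)`, where `𝔰𝔩₂(ℤ_ℓ)` is the module of `2 × 2` matrices of trace `0`. -/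
noncomputable def scaledSl (ℓ : ℕ) [Fact ℓ.Prime] (k : ℕ) :
    Submodule ℤ_[ℓ] (Matrix (Fin 2) (Fin 2) ℤ_[ℓ]) :=
  ((ℓ : ℤ_[ℓ]) ^ k) • LinearMap.ker (Matrix.traceLinearMap (Fin 2) ℤ_[ℓ] ℤ_[ℓ])

/-- The reduction `[x]` modulo `ℓ` of an element of `SL₂(ℤ_ℓ)`. -/
noncomputable def red (ℓ : ℕ) [Fact ℓ.Prime] : SL(2, ℤ_[ℓ]) →* SL(2, ZMod ℓ) :=
  Matrix.SpecialLinearGroup.map (n := Fin 2) (PadicInt.toZMod (p := ℓ))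

/-- The matrix `x` is a multiple of the identity. -/
def IsScalar {ℓ : ℕ} (x : SL(2, ZMod ℓ)) : Prop :=
  ∃ c : ZMod ℓ, (x : Matrix (Fin 2) (Fin 2) (ZMod ℓ)) = c • 1

end PinkSL2

/-!
Let `Γ = G ∩ 𝓑_ℓ(1, 1)`.

Put `L₀ = 𝓛(Γ)` and `L_{j+1} = [L₀, L_j]`. Modulo the next step of this filtration `Θ₂` is additive,
and it carries group commutators to Lie brackets, so successive approximation shows that `Γ`, being
closed, contains every `h ∈ 𝓑_ℓ(1, 1)` with `Θ₂(h) ∈ [L₀, L₀]`.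

Let `ℓ ^ e` be the largest power of `ℓ` dividing `tr x₁ - tr x₂` for all `x ∈ Γ`. Since `L₀` is
stable under multiplication by `(tr x₁, tr x₂)` for `x ∈ Γ`, it contains multiples of `𝔰𝔩₂ ⊕ 0` and
`0 ⊕ 𝔰𝔩₂` of exponent about `e`. Hence `Γ` contains a ball of radius about `e`, and commutators with
lifts of unipotent matrices of `G₁` and `G₂` put a slightly smaller ball in `G'`. This settles the
case where `e` is bounded in terms of `n₁` and `n₂`.

If `e` is large, the algebra spanned by `Γ` is conjugate to the diagonal of `M₂(ℤ_ℓ)²` up to bounded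
powers of `ℓ`. An element of `G` normalizes this algebra, so its components correspond to each other
under that conjugation up to a sign, and `T` consists of the elements of sign `1`: the traces of
`t₁` and `t₂` agree modulo a power of `ℓ` of exponent about `e`. In particular `e` is at most about
`k` whenever `𝓛(T)` contains `ℓ ^ k 𝔰𝔩₂ ⊕ ℓ ^ k 𝔰𝔩₂`.
-/

namespace PinkSL2

open scoped commutatorElement

attribute [local instance] LieRing.ofAssociativeRing

/-- The `2 × 2` matrices over `ℤ_ℓ`. -/
abbrev Mat (ℓ : ℕ) [Fact ℓ.Prime] := Matrix (Fin 2) (Fin 2) ℤ_[ℓ]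

/-- The group `SL₂(ℤ_ℓ)²`. -/
abbrev SLpair (ℓ : ℕ) [Fact ℓ.Prime] := SL(2, ℤ_[ℓ]) × SL(2, ℤ_[ℓ])

/-- The ring `M₂(ℤ_ℓ)²`. -/
abbrev MatPair (ℓ : ℕ) [Fact ℓ.Prime] := Mat ℓ × Mat ℓ

variable {ℓ : ℕ} [Fact ℓ.Prime]

section Arithmetic

theorem natCast_self_ne_zero : (ℓ : ℤ_[ℓ]) ≠ 0 := PadicInt.prime_p.ne_zero

theorem isUnit_iff_not_dvd {u : ℤ_[ℓ]} : IsUnit u ↔ ¬ (ℓ : ℤ_[ℓ]) ∣ u := by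
  rw [← PadicInt.norm_lt_one_iff_dvd, ← PadicInt.not_isUnit_iff, not_not]

theorem isUnit_of_dvd_sub {u v : ℤ_[ℓ]} (hv : IsUnit v) (h : (ℓ : ℤ_[ℓ]) ∣ u - v) :
    IsUnit u := by
  rw [isUnit_iff_not_dvd] at hv ⊢
  exact fun hu => hv ((dvd_iff_dvd_of_dvd_sub h).1 hu)

theorem isUnit_natCast {k : ℕ} (hk : ¬ ℓ ∣ k) : IsUnit (k : ℤ_[ℓ]) := by
  rw [isUnit_iff_not_dvd]
  have h := PadicInt.pow_p_dvd_int_iff (p := ℓ) 1 k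
  simp only [pow_one, Int.cast_natCast, Int.natCast_dvd_natCast] at h
  rwa [h]

theorem isUnit_two (hℓ : 2 < ℓ) : IsUnit (2 : ℤ_[ℓ]) := by
  exact_mod_cast isUnit_natCast (Nat.not_dvd_of_pos_of_lt two_pos hℓ)

theorem isUnit_add_one (hℓ : 2 < ℓ) {v : ℤ_[ℓ]} (h : (ℓ : ℤ_[ℓ]) ∣ v - 1) : IsUnit (v + 1) :=
  isUnit_of_dvd_sub (isUnit_two hℓ) (by convert h using 1; ring)

theorem pow_dvd_pow_iff_le {a b : ℕ} : (ℓ : ℤ_[ℓ]) ^ a ∣ (ℓ : ℤ_[ℓ]) ^ b ↔ a ≤ b :=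
  pow_dvd_pow_iff natCast_self_ne_zero PadicInt.prime_p.not_isUnit

theorem pow_dvd_of_pow_dvd_mul {a b c : ℕ} (hab : b + c ≤ a) {x : ℤ_[ℓ]}
    (h : (ℓ : ℤ_[ℓ]) ^ a ∣ (ℓ : ℤ_[ℓ]) ^ b * x) : (ℓ : ℤ_[ℓ]) ^ c ∣ x := by
  refine (mul_dvd_mul_iff_left (pow_ne_zero b natCast_self_ne_zero)).1 ?_
  rw [← pow_add]
  exact (pow_dvd_pow _ hab).trans h

theorem exists_sq_eq_of_sub_one_mem {R : Type*} [CommRing R] {I : Ideal R} [HenselianRing R I]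
    (h2 : IsUnit (2 : R)) {u : R} (hu : u - 1 ∈ I) : ∃ v, v ^ 2 = u ∧ v - 1 ∈ I := by
  obtain ⟨v, hv, hv1⟩ := HenselianRing.is_henselian (I := I) (Polynomial.X ^ 2 - Polynomial.C u)
    (Polynomial.monic_X_pow_sub_C u two_ne_zero) 1 (by simpa using I.neg_mem hu)
    (by simpa [Polynomial.derivative_X_pow, one_add_one_eq_two] using h2.map (Ideal.Quotient.mk I))
  exact ⟨v, by simpa [sub_eq_zero] using hv, hv1⟩

theorem exists_sq_eq (hℓ : 2 < ℓ) {c : ℕ} (hc : 0 < c) {u : ℤ_[ℓ]}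
    (hu : (ℓ : ℤ_[ℓ]) ^ c ∣ u - 1) : ∃ v : ℤ_[ℓ], v ^ 2 = u ∧ (ℓ : ℤ_[ℓ]) ^ c ∣ v - 1 := by
  have mem_iff (x : ℤ_[ℓ]) : x ∈ IsLocalRing.maximalIdeal ℤ_[ℓ] ↔ (ℓ : ℤ_[ℓ]) ∣ x := by
    rw [PadicInt.maximalIdeal_eq_span_p, Ideal.mem_span_singleton]
  obtain ⟨v, rfl, hv⟩ := exists_sq_eq_of_sub_one_mem (isUnit_two hℓ)
    ((mem_iff _).2 ((dvd_pow_self _ hc.ne').trans hu))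
  refine ⟨v, rfl, (isUnit_add_one hℓ ((mem_iff _).1 hv)).dvd_mul_left.1 ?_⟩
  convert hu using 1
  ring

end Arithmetic

section Multiples

variable {R M N : Type*} [CommRing R] [AddCommGroup M] [Module R M] [AddCommGroup N] [Module R N]

theorem mem_smul_top_iff {c : R} {X : M} : X ∈ c • (⊤ : Submodule R M) ↔ ∃ Y, c • Y = X := by
  simp [Submodule.mem_smul_pointwise_iff_exists]

theorem smul_mem_smul_top (c : R) (X : M) : c • X ∈ c • (⊤ : Submodule R M) :=
  mem_smul_top_iff.2 ⟨X, rfl⟩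

theorem mem_smul_top_of_dvd {c d : R} (h : c ∣ d) {X : M} (hX : X ∈ d • (⊤ : Submodule R M)) :
    X ∈ c • (⊤ : Submodule R M) := by
  obtain ⟨Y, rfl⟩ := mem_smul_top_iff.1 hX
  obtain ⟨e, rfl⟩ := h
  exact mem_smul_top_iff.2 ⟨e • Y, smul_smul c e Y⟩

theorem smul_mem_smul_top_of_dvd {c d : R} (h : c ∣ d) (X : M) : d • X ∈ c • (⊤ : Submodule R M) :=
  mem_smul_top_of_dvd h (smul_mem_smul_top d X)

theorem map_mem_smul_top (f : M →ₗ[R] N) {c : R} {X : M} (hX : X ∈ c • (⊤ : Submodule R M)) :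
    f X ∈ c • (⊤ : Submodule R N) := by
  obtain ⟨Y, rfl⟩ := mem_smul_top_iff.1 hX
  exact mem_smul_top_iff.2 ⟨f Y, (map_smul f c Y).symm⟩

theorem matrix_mem_smul_top_iff {m n : Type*} {c : R} {X : Matrix m n R} :
    X ∈ c • (⊤ : Submodule R (Matrix m n R)) ↔ ∀ i j, c ∣ X i j := by
  rw [mem_smul_top_iff]
  refine ⟨?_, fun h => ?_⟩
  · rintro ⟨Y, rfl⟩ i j
    exact dvd_mul_right c (Y i j)
  · choose Y hY using h
    exact ⟨Matrix.of Y, Matrix.ext fun i j => (hY i j).symm⟩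

theorem mul_mem_smul_top {A : Type*} [Ring A] [Algebra R A] {c d : R} {X Y : A}
    (hX : X ∈ c • (⊤ : Submodule R A)) (hY : Y ∈ d • (⊤ : Submodule R A)) :
    X * Y ∈ (c * d) • (⊤ : Submodule R A) := by
  obtain ⟨X, rfl⟩ := mem_smul_top_iff.1 hX
  obtain ⟨Y, rfl⟩ := mem_smul_top_iff.1 hY
  exact mem_smul_top_iff.2 ⟨X * Y, (smul_mul_smul_comm c X d Y).symm⟩

theorem dvd_trace_of_mem_smul_top {n : Type*} [Fintype n] {c : R} {X : Matrix n n R}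
    (hX : X ∈ c • (⊤ : Submodule R (Matrix n n R))) : c ∣ X.trace :=
  Finset.dvd_sum fun i _ => matrix_mem_smul_top_iff.1 hX i i

end Multiples

section Balls

theorem map_eq_one_iff_sub_mem_ker {n R S : Type*} [DecidableEq n] [Fintype n] [CommRing R]
    [CommRing S] (f : R →+* S) {x : Matrix.SpecialLinearGroup n R} :
    Matrix.SpecialLinearGroup.map f x = 1 ↔
      ∀ i j, x.1 i j - (1 : Matrix n n R) i j ∈ RingHom.ker f := by
  rw [Matrix.SpecialLinearGroup.ext_iff]
  simp only [RingHom.mem_ker, map_sub, sub_eq_zero, Matrix.SpecialLinearGroup.map_apply_coe,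
    RingHom.mapMatrix_apply, Matrix.map_apply, Matrix.SpecialLinearGroup.coe_one]
  refine forall₂_congr fun i j => ?_
  rw [Matrix.one_apply, Matrix.one_apply, apply_ite f, map_one, map_zero]

theorem mem_ball_iff {s : ℕ} {x : SL(2, ℤ_[ℓ])} :
    x ∈ ball ℓ s ↔ (x : Mat ℓ) - 1 ∈ (ℓ : ℤ_[ℓ]) ^ s • (⊤ : Submodule ℤ_[ℓ] (Mat ℓ)) := by
  rw [ball, MonoidHom.mem_ker, map_eq_one_iff_sub_mem_ker, matrix_mem_smul_top_iff]
  simp only [PadicInt.ker_toZModPow, Ideal.mem_span_singleton, Matrix.sub_apply]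

theorem mem_ball_iff_entries {s : ℕ} {x : SL(2, ℤ_[ℓ])} :
    x ∈ ball ℓ s ↔ (ℓ : ℤ_[ℓ]) ^ s ∣ x.1 0 0 - 1 ∧ (ℓ : ℤ_[ℓ]) ^ s ∣ x.1 0 1 ∧
      (ℓ : ℤ_[ℓ]) ^ s ∣ x.1 1 0 ∧ (ℓ : ℤ_[ℓ]) ^ s ∣ x.1 1 1 - 1 := by
  rw [mem_ball_iff, matrix_mem_smul_top_iff]
  simp [Fin.forall_fin_two, and_assoc]

theorem mem_ball_one_iff {x : SL(2, ℤ_[ℓ])} : x ∈ ball ℓ 1 ↔ red ℓ x = 1 := by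
  rw [red, map_eq_one_iff_sub_mem_ker, mem_ball_iff, matrix_mem_smul_top_iff,
    PadicInt.ker_toZMod, PadicInt.maximalIdeal_eq_span_p]
  simp only [pow_one, Ideal.mem_span_singleton, Matrix.sub_apply]

theorem ball_anti {s t : ℕ} (h : s ≤ t) : ball ℓ t ≤ ball ℓ s := fun _ hx =>
  mem_ball_iff.2 (mem_smul_top_of_dvd (pow_dvd_pow _ h) (mem_ball_iff.1 hx))

theorem ball₂_anti {s t : ℕ} (h : s ≤ t) : ball₂ ℓ t t ≤ ball₂ ℓ s s :=
  Subgroup.prod_mono (ball_anti h) (ball_anti h)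

theorem mem_ball₂ {s : ℕ} {x : SLpair ℓ} : x ∈ ball₂ ℓ s s ↔ x.1 ∈ ball ℓ s ∧ x.2 ∈ ball ℓ s :=
  Subgroup.mem_prod

instance ball_normal (s : ℕ) : (ball ℓ s).Normal := MonoidHom.normal_ker _

instance ball₂_normal (s : ℕ) : (ball₂ ℓ s s).Normal := Subgroup.prod_normal _ _

theorem isOpen_ball (s : ℕ) : IsOpen (ball ℓ s : Set SL(2, ℤ_[ℓ])) := by
  have h : (ball ℓ s : Set SL(2, ℤ_[ℓ])) = ⋂ i, ⋂ j, {x | ‖x.1 i j - (1 : Mat ℓ) i j‖ <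
      (ℓ : ℝ) ^ (-(s : ℤ) + 1)} := by
    ext x
    simp only [SetLike.mem_coe, mem_ball_iff, matrix_mem_smul_top_iff, Set.mem_iInter,
      Set.mem_ofPred_eq, ← PadicInt.norm_le_pow_iff_norm_lt_pow_add_one,
      PadicInt.norm_le_pow_iff_mem_span_pow, Ideal.mem_span_singleton, Matrix.sub_apply]
  rw [h]
  refine isOpen_iInter_of_finite fun i => isOpen_iInter_of_finite fun j => ?_
  exact isOpen_lt (((continuous_subtype_val.matrix_elem i j).sub continuous_const).norm)
    continuous_const

theorem isOpen_ball₂ (s : ℕ) : IsOpen (ball₂ ℓ s s : Set (SLpair ℓ)) := by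
  rw [ball₂, Subgroup.coe_prod]
  exact (isOpen_ball s).prod (isOpen_ball s)

theorem tendsto_one_of_mem_ball {x : ℕ → SL(2, ℤ_[ℓ])} (hx : ∀ s, x s ∈ ball ℓ s) :
    Filter.Tendsto x Filter.atTop (nhds 1) := by
  refine tendsto_subtype_rng.2 (tendsto_pi_nhds.2 fun i => tendsto_pi_nhds.2 fun j => ?_)
  rw [Metric.tendsto_atTop]
  intro ε hε
  obtain ⟨s, hs⟩ := PadicInt.exists_pow_neg_lt ℓ hε
  refine ⟨s, fun t hst => ?_⟩
  have hdvd := matrix_mem_smul_top_iff.1 (mem_ball_iff.1 (ball_anti hst (hx t))) i j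
  rw [← Ideal.mem_span_singleton, ← PadicInt.norm_le_pow_iff_mem_span_pow] at hdvd
  exact (dist_eq_norm _ _).trans_lt (hdvd.trans_lt hs)

theorem exists_ball_subset {U : Set SL(2, ℤ_[ℓ])} (hU : U ∈ nhds 1) :
    ∃ s, (ball ℓ s : Set SL(2, ℤ_[ℓ])) ⊆ U := by
  by_contra! h
  simp only [Set.not_subset] at h
  choose x hx hxU using h
  obtain ⟨s, hs⟩ := ((tendsto_one_of_mem_ball hx).eventually_mem hU).exists
  exact hxU s hs

theorem exists_ball₂_le {G : Subgroup (SLpair ℓ)} (hG : IsOpen (G : Set (SLpair ℓ))) :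
    ∃ s, ball₂ ℓ s s ≤ G := by
  obtain ⟨U, hU, V, hV, hUV⟩ := mem_nhds_prod_iff.1 (hG.mem_nhds G.one_mem)
  obtain ⟨s, hs⟩ := exists_ball_subset hU
  obtain ⟨t, ht⟩ := exists_ball_subset hV
  exact ⟨max s t, fun x hx => hUV ⟨hs (ball_anti (le_max_left s t) (mem_ball₂.1 hx).1),
    ht (ball_anti (le_max_right s t) (mem_ball₂.1 hx).2)⟩⟩

end Balls

section LieSeries

variable {R L : Type*} [CommRing R] [LieRing L] [LieAlgebra R L]

/-- The descending central series of a submodule `M` of a Lie algebra: `L₀ = M` and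
`L_{j+1} = [M, L_j]`. -/
noncomputable def lieSeries (M : Submodule R L) : ℕ → Submodule R L
  | 0 => M
  | j + 1 => Submodule.map₂ (LieModule.toEnd R L L : L →ₗ[R] Module.End R L) M (lieSeries M j)

variable {M : Submodule R L}

theorem lie_mem_lieSeries_succ {j : ℕ} {X Y : L} (hX : X ∈ M) (hY : Y ∈ lieSeries M j) :
    ⁅X, Y⁆ ∈ lieSeries M (j + 1) :=
  Submodule.apply_mem_map₂ (LieModule.toEnd R L L : L →ₗ[R] Module.End R L) hX hY

theorem lieSeries_succ_le_iff {j : ℕ} {P : Submodule R L} :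
    lieSeries M (j + 1) ≤ P ↔ ∀ X ∈ M, ∀ Y ∈ lieSeries M j, ⁅X, Y⁆ ∈ P :=
  Submodule.map₂_le

theorem lieSeries_succ_eq_span {S T : Set L} (hS : Submodule.span R S = M) {j : ℕ}
    (hT : Submodule.span R T = lieSeries M j) :
    lieSeries M (j + 1) = Submodule.span R (Set.image2 (fun X Y => ⁅X, Y⁆) S T) := by
  rw [lieSeries, ← hT]
  nth_rw 1 [← hS]
  exact Submodule.map₂_span_span R _ S T

theorem lieSeries_antitone (hM : ∀ X ∈ M, ∀ Y ∈ M, ⁅X, Y⁆ ∈ M) : Antitone (lieSeries M) := by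
  refine antitone_nat_of_succ_le fun j => ?_
  induction j with
  | zero => exact lieSeries_succ_le_iff.2 hM
  | succ j ih =>
    exact lieSeries_succ_le_iff.2 fun X hX Y hY => lie_mem_lieSeries_succ hX (ih hY)

theorem lieSeries_le {P : Submodule R L} (hMP : M ≤ P) (hP : ∀ X ∈ P, ∀ Y ∈ P, ⁅X, Y⁆ ∈ P)
    (j : ℕ) : lieSeries M j ≤ P := by
  induction j with
  | zero => exact hMP
  | succ j ih => exact lieSeries_succ_le_iff.2 fun X hX Y hY => hP X (hMP hX) Y (ih hY)

theorem lie_mem_lieSeries {i j k : ℕ} (hk : i + j + 1 = k) {X Y : L} (hX : X ∈ lieSeries M i)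
    (hY : Y ∈ lieSeries M j) : ⁅X, Y⁆ ∈ lieSeries M k := by
  induction i generalizing j k X Y with
  | zero =>
    obtain rfl : j + 1 = k := by omega
    exact lie_mem_lieSeries_succ hX hY
  | succ i ih =>
    suffices h : lieSeries M (i + 1) ≤
        (lieSeries M k).comap ((LieModule.toEnd R L L : L →ₗ[R] Module.End R L).flip Y) from h hX
    refine lieSeries_succ_le_iff.2 fun U hU W hW => ?_
    obtain ⟨k, rfl⟩ : ∃ k', k = k' + 1 := ⟨i + j + 1, by omega⟩
    change ⁅⁅U, W⁆, Y⁆ ∈ lieSeries M (k + 1)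
    rw [lie_lie]
    exact sub_mem (lie_mem_lieSeries_succ hU (ih (by omega) hW hY))
      (ih (by omega) hW (lie_mem_lieSeries_succ hU hY))

theorem lieSeries_le_pow_smul_top {c : R} (hM : M ≤ c • ⊤) (j : ℕ) :
    lieSeries M j ≤ c ^ (j + 1) • ⊤ := by
  induction j with
  | zero => rwa [zero_add, pow_one]
  | succ j ih =>
    refine lieSeries_succ_le_iff.2 fun X hX Y hY => ?_
    obtain ⟨X, rfl⟩ := mem_smul_top_iff.1 (hM hX)
    obtain ⟨Y, rfl⟩ := mem_smul_top_iff.1 (ih hY)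
    exact mem_smul_top_iff.2 ⟨⁅X, Y⁆, by rw [pow_succ' c (j + 1), smul_lie, lie_smul, smul_smul]⟩

end LieSeries

section Anticommutators

variable {R A : Type*} [CommRing R] [Ring A] [Algebra R A]

theorem lie_lie_eq_of_commute {a b c : A} (hb : Commute (a * b + b * a) c)
    (hc : Commute (a * c + c * a) b) :
    ⁅a, ⁅c, b⁆⁆ = 2 * ((a * c + c * a) * b - (a * b + b * a) * c) := by
  calc ⁅a, ⁅c, b⁆⁆ = ((a * c + c * a) * b + b * (a * c + c * a)) -
        ((a * b + b * a) * c + c * (a * b + b * a)) := by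
        simp only [Ring.lie_def]
        noncomm_ring
    _ = _ := by
        rw [← hb.eq, ← hc.eq]
        noncomm_ring

theorem two_mul_anticommutator_mul_lie_sub {a b c : A}
    (hb : a * b + b * a ∈ Subring.center A) (hc : a * c + c * a ∈ Subring.center A) (d : A) :
    2 * ((a * b + b * a) * ⁅c, d⁆ - (a * c + c * a) * ⁅b, d⁆) = -⁅⁅a, ⁅c, b⁆⁆, d⁆ := by
  have hbd := (Subring.mem_center_iff.1 hb d).symm
  have hcd := (Subring.mem_center_iff.1 hc d).symm
  rw [lie_lie_eq_of_commute (Subring.mem_center_iff.1 hb c).symm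
    (Subring.mem_center_iff.1 hc b).symm]
  generalize a * b + b * a = β at *
  generalize a * c + c * a = γ at *
  calc 2 * (β * ⁅c, d⁆ - γ * ⁅b, d⁆)
      = -(2 * (γ * b - β * c) * d - 2 * ((γ * d) * b - (β * d) * c)) := by
        simp only [Ring.lie_def]
        noncomm_ring
    _ = _ := by
        rw [hbd, hcd]
        simp only [Ring.lie_def]
        noncomm_ring

variable {M P : Submodule R A}

theorem anticommutator_mul_lie_sub_mem_lieSeries (h2 : IsUnit (2 : R)) (hMP : M ≤ P)
    (hlie : ∀ X ∈ P, ∀ Y ∈ P, ⁅X, Y⁆ ∈ P)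
    (hcenter : ∀ X ∈ P, ∀ Y ∈ P, X * Y + Y * X ∈ Subring.center A) {p q r s k : ℕ}
    (hk : p + q + r + s + 3 = k) {a b c d : A} (ha : a ∈ lieSeries M p) (hb : b ∈ lieSeries M q)
    (hc : c ∈ lieSeries M r) (hd : d ∈ lieSeries M s) :
    (a * b + b * a) * ⁅c, d⁆ - (a * c + c * a) * ⁅b, d⁆ ∈ lieSeries M k := by
  have hP := lieSeries_le hMP hlie
  rw [← Submodule.smul_mem_iff_of_isUnit _ h2, ofNat_smul_eq_nsmul, nsmul_eq_mul, Nat.cast_ofNat,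
    two_mul_anticommutator_mul_lie_sub (hcenter a (hP p ha) b (hP q hb))
      (hcenter a (hP p ha) c (hP r hc))]
  exact neg_mem (lie_mem_lieSeries (by omega)
    (lie_mem_lieSeries rfl ha (lie_mem_lieSeries rfl hc hb)) hd)

-- Four applications of the preceding lemma move the anticommutator all the way around
-- `X, U, W, Y` and back, with the opposite sign.
theorem anticommutator_mul_mem_lieSeries (h2 : IsUnit (2 : R)) (hMP : M ≤ P)
    (hlie : ∀ X ∈ P, ∀ Y ∈ P, ⁅X, Y⁆ ∈ P)
    (hcenter : ∀ X ∈ P, ∀ Y ∈ P, X * Y + Y * X ∈ Subring.center A) {j : ℕ} {X Y Z : A}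
    (hX : X ∈ M) (hY : Y ∈ M) (hZ : Z ∈ lieSeries M (j + 1)) :
    (X * Y + Y * X) * Z ∈ lieSeries M (j + 3) := by
  suffices h : lieSeries M (j + 1) ≤
      (lieSeries M (j + 3)).comap (LinearMap.mulLeft R (X * Y + Y * X)) from h hZ
  refine lieSeries_succ_le_iff.2 fun U hU W hW => ?_
  rw [Submodule.mem_comap, LinearMap.mulLeft_apply]
  have swap {p q r s : ℕ} (hj : p + q + r + s = j) {a b c d : A} (ha : a ∈ lieSeries M p)
      (hb : b ∈ lieSeries M q) (hc : c ∈ lieSeries M r) (hd : d ∈ lieSeries M s) :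
      (a * b + b * a) * ⁅c, d⁆ - (a * c + c * a) * ⁅b, d⁆ ∈ lieSeries M (j + 3) :=
    anticommutator_mul_lie_sub_mem_lieSeries h2 hMP hlie hcenter (by omega) ha hb hc hd
  have h₁ := swap (p := 0) (q := 0) (r := 0) (by omega) hX hY hU hW
  have h₂ := swap (p := 0) (q := 0) (s := 0) (by omega) hU hX hW hY
  have h₃ := swap (q := 0) (r := 0) (s := 0) (by omega) hW hU hX hY
  have h₄ := swap (p := 0) (r := 0) (s := 0) (by omega) hX hW hY hU
  rw [← Submodule.smul_mem_iff_of_isUnit _ h2]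
  convert add_mem (sub_mem (sub_mem h₁ h₂) h₃) h₄ using 1
  rw [two_smul]
  simp only [Ring.lie_def]
  noncomm_ring

end Anticommutators

section Scale

variable {R M N : Type*} [CommRing R] [AddCommGroup M] [Module R M] [AddCommGroup N] [Module R N]

/-- The componentwise action of `R × R` on a product of two `R`-modules. -/
def scale (c : R × R) : M × N →ₗ[R] M × N :=
  (c.1 • LinearMap.id).prodMap (c.2 • LinearMap.id)

@[simp] theorem scale_apply (c : R × R) (X : M × N) : scale c X = (c.1 • X.1, c.2 • X.2) := rfl

theorem scale_sub_one_mem {P Q : Submodule R (M × N)} (hQP : Q ≤ P) {τ : R × R}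
    (h₁ : IsUnit (τ.1 + 1)) (h₂ : IsUnit (τ.2 + 1)) (h₃ : IsUnit (τ.1 + τ.2))
    (h : ∀ Y ∈ P, scale (τ ^ 2 - 1) Y ∈ Q) {Y : M × N} (hY : Y ∈ P) : scale (τ - 1) Y ∈ Q := by
  set c := τ ^ 2 - 1 with hc
  have hnorm : (c.1 * c.2) • Y ∈ Q := by
    have : (c.1 * c.2) • Y = (c.1 + c.2) • scale c Y - scale c (scale c Y) := by
      ext1 <;> simp only [scale_apply, Prod.smul_fst, Prod.smul_snd, Prod.fst_sub, Prod.snd_sub] <;>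
        module
    rw [this]
    exact sub_mem (Q.smul_mem _ (h Y hY)) (h _ (hQP (h Y hY)))
  have hnorm' : ((τ.1 - 1) * (τ.2 - 1)) • Y ∈ Q := by
    rw [← Q.smul_mem_iff_of_isUnit (h₁.mul h₂), smul_smul]
    convert hnorm using 2
    simp only [hc, Prod.fst_sub, Prod.snd_sub, Prod.pow_fst, Prod.pow_snd, Prod.fst_one,
      Prod.snd_one]
    ring
  -- `(τ₁ + τ₂) (τᵢ - 1) = (τ₁ - 1) (τ₂ - 1) + (τᵢ ^ 2 - 1)`
  rw [← Q.smul_mem_iff_of_isUnit h₃]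
  convert add_mem hnorm' (h Y hY) using 1
  ext1 <;> simp only [hc, scale_apply, Prod.smul_fst, Prod.smul_snd, Prod.fst_add, Prod.snd_add,
    Prod.fst_sub, Prod.snd_sub, Prod.pow_fst, Prod.pow_snd, Prod.fst_one, Prod.snd_one] <;> module

end Scale

section Traceless

variable {K : Type*} [CommRing K] {X Y : Matrix (Fin 2) (Fin 2) K}

theorem exists_eq_of_trace_eq_zero (hX : X.trace = 0) : ∃ a b c, X = !![a, b; c, -a] := by
  rw [Matrix.trace_fin_two] at hX
  exact ⟨X 0 0, X 0 1, X 1 0, by rw [← eq_neg_of_add_eq_zero_right hX, ← Matrix.eta_fin_two X]⟩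

theorem anticommutator_eq_trace_smul_one (hX : X.trace = 0) (hY : Y.trace = 0) :
    X * Y + Y * X = (X * Y).trace • 1 := by
  obtain ⟨a, b, c, rfl⟩ := exists_eq_of_trace_eq_zero hX
  obtain ⟨d, e, f, rfl⟩ := exists_eq_of_trace_eq_zero hY
  ext i j
  fin_cases i <;> fin_cases j <;> simp [Matrix.trace_fin_two] <;> ring

theorem mul_sub_trace_smul_one {h : K} (hh : h * 2 = 1) (hX : X.trace = 0) (hY : Y.trace = 0) :
    X * Y - (h * (X * Y).trace) • 1 = h • ⁅X, Y⁆ := by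
  rw [mul_smul, ← anticommutator_eq_trace_smul_one hX hY, Ring.lie_def]
  calc _ = (h * 2) • (X * Y) - h • (X * Y + Y * X) := by rw [hh, one_smul]
    _ = _ := by module

theorem adjugate_eq_trace_smul_one_sub (X : Matrix (Fin 2) (Fin 2) K) :
    X.adjugate = X.trace • 1 - X := by
  rw [Matrix.adjugate_fin_two]
  ext i j
  fin_cases i <;> fin_cases j <;> simp [Matrix.trace_fin_two]

theorem det_smul_one_add (t : K) (X : Matrix (Fin 2) (Fin 2) K) :
    (t • 1 + X).det = t ^ 2 + t * X.trace + X.det := by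
  simp only [Matrix.det_fin_two, Matrix.trace_fin_two, Matrix.add_apply, Matrix.smul_apply,
    Matrix.one_apply, smul_eq_mul]
  simp
  ring

theorem dvd_det_of_mem_smul_top {c : K}
    (hX : X ∈ c • (⊤ : Submodule K (Matrix (Fin 2) (Fin 2) K))) : c ∣ X.det := by
  rw [matrix_mem_smul_top_iff] at hX
  rw [Matrix.det_fin_two]
  exact dvd_sub ((hX 0 0).mul_right _) ((hX 0 1).mul_right _)

end Traceless

section Theta

theorem half_mul_two (hℓ : 2 < ℓ) : Ring.inverse (2 : ℤ_[ℓ]) * 2 = 1 :=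
  Ring.inverse_mul_cancel _ (isUnit_two hℓ)

theorem mem_scaledSl {k : ℕ} {X : Mat ℓ} :
    X ∈ scaledSl ℓ k ↔ X.trace = 0 ∧ X ∈ (ℓ : ℤ_[ℓ]) ^ k • (⊤ : Submodule ℤ_[ℓ] (Mat ℓ)) := by
  simp only [scaledSl, Submodule.mem_smul_pointwise_iff_exists, LinearMap.mem_ker,
    Matrix.traceLinearMap_apply, Submodule.mem_top, true_and]
  constructor
  · rintro ⟨Y, hY, rfl⟩
    exact ⟨by rw [Matrix.trace_smul, hY, smul_zero], Y, rfl⟩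
  · rintro ⟨htr, Y, rfl⟩
    rw [Matrix.trace_smul, smul_eq_zero_iff_right (pow_ne_zero k natCast_self_ne_zero)] at htr
    exact ⟨Y, htr, rfl⟩

theorem mem_scaledSl_zero {X : Mat ℓ} : X ∈ scaledSl ℓ 0 ↔ X.trace = 0 := by
  simp [mem_scaledSl]

theorem pow_smul_mem_scaledSl {k : ℕ} {X : Mat ℓ} (hX : X.trace = 0) :
    (ℓ : ℤ_[ℓ]) ^ k • X ∈ scaledSl ℓ k :=
  mem_scaledSl.2 ⟨by rw [Matrix.trace_smul, hX, smul_zero], smul_mem_smul_top _ X⟩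

/-- Half of the trace, so that `x = tau x • 1 + theta₁ ℓ x`. -/
noncomputable def tau (x : SL(2, ℤ_[ℓ])) : ℤ_[ℓ] := Ring.inverse 2 * (x : Mat ℓ).trace

theorem coe_eq_tau_smul_one_add_theta₁ (x : SL(2, ℤ_[ℓ])) :
    (x : Mat ℓ) = tau x • 1 + theta₁ ℓ x := by
  simp [tau, theta₁]

theorem trace_eq_two_mul_tau (hℓ : 2 < ℓ) (x : SL(2, ℤ_[ℓ])) :
    (x : Mat ℓ).trace = 2 * tau x := by
  rw [tau, mul_left_comm, ← mul_assoc, half_mul_two hℓ, one_mul]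

theorem tau_eq_and_theta₁_eq (hℓ : 2 < ℓ) {x : SL(2, ℤ_[ℓ])} {s : ℤ_[ℓ]} {X : Mat ℓ}
    (hX : X.trace = 0) (h : (x : Mat ℓ) = s • 1 + X) : tau x = s ∧ theta₁ ℓ x = X := by
  have hs : tau x = s := by
    rw [tau, h, Matrix.trace_add, hX, Matrix.trace_smul, Matrix.trace_one, Fintype.card_fin,
      smul_eq_mul, add_zero, mul_comm s, ← mul_assoc, Nat.cast_ofNat, half_mul_two hℓ, one_mul]
  exact ⟨hs, by rwa [coe_eq_tau_smul_one_add_theta₁, hs, add_right_inj] at h⟩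

theorem trace_theta₁ (hℓ : 2 < ℓ) (x : SL(2, ℤ_[ℓ])) : (theta₁ ℓ x).trace = 0 := by
  have h := congrArg Matrix.trace (coe_eq_tau_smul_one_add_theta₁ x)
  rwa [Matrix.trace_add, Matrix.trace_smul, Matrix.trace_one, trace_eq_two_mul_tau hℓ,
    Fintype.card_fin, smul_eq_mul, mul_comm, Nat.cast_ofNat, left_eq_add] at h

theorem theta₁_one (hℓ : 2 < ℓ) : theta₁ ℓ 1 = 0 :=
  (tau_eq_and_theta₁_eq hℓ (s := 1) (Matrix.trace_zero _ _) (by simp)).2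

theorem coe_inv_eq (hℓ : 2 < ℓ) (x : SL(2, ℤ_[ℓ])) :
    ((x⁻¹ : SL(2, ℤ_[ℓ])) : Mat ℓ) = tau x • 1 - theta₁ ℓ x := by
  rw [Matrix.SpecialLinearGroup.coe_inv, adjugate_eq_trace_smul_one_sub, trace_eq_two_mul_tau hℓ,
    coe_eq_tau_smul_one_add_theta₁ x]
  module

theorem theta₁_inv (hℓ : 2 < ℓ) (x : SL(2, ℤ_[ℓ])) : theta₁ ℓ x⁻¹ = -theta₁ ℓ x :=
  (tau_eq_and_theta₁_eq hℓ (by rw [Matrix.trace_neg, trace_theta₁ hℓ, neg_zero])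
    ((coe_inv_eq hℓ x).trans (sub_eq_add_neg _ _))).2

theorem theta₁_mul_self (hℓ : 2 < ℓ) (x : SL(2, ℤ_[ℓ])) :
    theta₁ ℓ x * theta₁ ℓ x = (tau x ^ 2 - 1) • 1 := by
  have h : (x : Mat ℓ) * (x⁻¹ : SL(2, ℤ_[ℓ])) = 1 := by
    rw [← Matrix.SpecialLinearGroup.coe_mul, mul_inv_cancel, Matrix.SpecialLinearGroup.coe_one]
  have h' : (tau x • (1 : Mat ℓ) + theta₁ ℓ x) * (tau x • 1 - theta₁ ℓ x) =
      tau x ^ 2 • 1 - theta₁ ℓ x * theta₁ ℓ x := by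
    simp only [add_mul, mul_sub, smul_mul_assoc, mul_smul_comm, one_mul, mul_one]
    module
  rw [coe_inv_eq hℓ, coe_eq_tau_smul_one_add_theta₁ x, h'] at h
  rw [sub_smul, one_smul]
  exact eq_sub_of_add_eq' (sub_eq_iff_eq_add.1 h).symm

theorem theta₁_mul (hℓ : 2 < ℓ) (x y : SL(2, ℤ_[ℓ])) : theta₁ ℓ (x * y) =
    tau x • theta₁ ℓ y + tau y • theta₁ ℓ x +
      Ring.inverse (2 : ℤ_[ℓ]) • ⁅theta₁ ℓ x, theta₁ ℓ y⁆ := by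
  have hX := trace_theta₁ hℓ x
  have hY := trace_theta₁ hℓ y
  refine (tau_eq_and_theta₁_eq hℓ (s := tau x * tau y +
    Ring.inverse (2 : ℤ_[ℓ]) * (theta₁ ℓ x * theta₁ ℓ y).trace) ?_ ?_).2
  · simp [hX, hY]
  · rw [Matrix.SpecialLinearGroup.coe_mul, coe_eq_tau_smul_one_add_theta₁ x,
      coe_eq_tau_smul_one_add_theta₁ y, ← mul_sub_trace_smul_one (half_mul_two hℓ) hX hY]
    simp only [add_mul, mul_add, smul_mul_assoc, mul_smul_comm, one_mul, mul_one]
    module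

theorem theta₁_mul_sub_theta₁_mul (hℓ : 2 < ℓ) (x y : SL(2, ℤ_[ℓ])) :
    theta₁ ℓ (x * y) - theta₁ ℓ (y * x) = ⁅theta₁ ℓ x, theta₁ ℓ y⁆ := by
  rw [theta₁_mul hℓ, theta₁_mul hℓ, ← lie_skew (theta₁ ℓ y)]
  calc _ = (Ring.inverse (2 : ℤ_[ℓ]) * 2) • ⁅theta₁ ℓ x, theta₁ ℓ y⁆ := by module
    _ = _ := by rw [half_mul_two hℓ, one_smul]

theorem coe_mul_sub_coe_mul (hℓ : 2 < ℓ) (x y : SL(2, ℤ_[ℓ])) :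
    ((x * y : SL(2, ℤ_[ℓ])) : Mat ℓ) - (y * x : SL(2, ℤ_[ℓ])) = ⁅theta₁ ℓ x, theta₁ ℓ y⁆ := by
  have htau : tau (x * y) = tau (y * x) := by
    rw [tau, tau, Matrix.SpecialLinearGroup.coe_mul, Matrix.SpecialLinearGroup.coe_mul,
      Matrix.trace_mul_comm]
  rw [← theta₁_mul_sub_theta₁_mul hℓ, coe_eq_tau_smul_one_add_theta₁ (x * y),
    coe_eq_tau_smul_one_add_theta₁ (y * x), htau, add_sub_add_left_eq_sub]

theorem coe_commutator_eq (hℓ : 2 < ℓ) (x y : SL(2, ℤ_[ℓ])) :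
    ((⁅x, y⁆ : SL(2, ℤ_[ℓ])) : Mat ℓ) =
      1 + ⁅theta₁ ℓ x, theta₁ ℓ y⁆ * (tau (y * x) • 1 - theta₁ ℓ (y * x)) := by
  have hc : ⁅x, y⁆ = x * y * (y * x)⁻¹ := by rw [commutatorElement_def]; group
  rw [hc, Matrix.SpecialLinearGroup.coe_mul, ← sub_add_cancel ((x * y : SL(2, ℤ_[ℓ])) : Mat ℓ)
    (y * x : SL(2, ℤ_[ℓ])), coe_mul_sub_coe_mul hℓ, add_mul, ← coe_inv_eq hℓ,
    ← Matrix.SpecialLinearGroup.coe_mul, mul_inv_cancel, Matrix.SpecialLinearGroup.coe_one,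
    add_comm]

theorem theta₁_commutator (hℓ : 2 < ℓ) (x y : SL(2, ℤ_[ℓ])) :
    theta₁ ℓ ⁅x, y⁆ = tau (y * x) • ⁅theta₁ ℓ x, theta₁ ℓ y⁆ -
      Ring.inverse (2 : ℤ_[ℓ]) • ⁅⁅theta₁ ℓ x, theta₁ ℓ y⁆, theta₁ ℓ (y * x)⁆ := by
  have htrace (X Y : Mat ℓ) : (⁅X, Y⁆ : Mat ℓ).trace = 0 :=
    LieAlgebra.matrix_trace_commutator_zero (Fin 2) ℤ_[ℓ] X Y
  refine (tau_eq_and_theta₁_eq hℓ (s := 1 - Ring.inverse (2 : ℤ_[ℓ]) *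
    (⁅theta₁ ℓ x, theta₁ ℓ y⁆ * theta₁ ℓ (y * x)).trace) ?_ ?_).2
  · rw [Matrix.trace_sub, Matrix.trace_smul, Matrix.trace_smul, htrace, htrace, smul_zero,
      smul_zero, sub_zero]
  · rw [coe_commutator_eq hℓ, ← mul_sub_trace_smul_one (half_mul_two hℓ) (htrace _ _)
      (trace_theta₁ hℓ (y * x)), mul_sub, mul_smul_comm, mul_one]
    module

theorem coe_sub_one_eq (x : SL(2, ℤ_[ℓ])) :
    (x : Mat ℓ) - 1 = (tau x - 1) • 1 + theta₁ ℓ x := by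
  rw [coe_eq_tau_smul_one_add_theta₁ x, sub_smul, one_smul]
  abel

theorem dvd_tau_sub_one (hℓ : 2 < ℓ) {s : ℕ} {x : SL(2, ℤ_[ℓ])} (hx : x ∈ ball ℓ s) :
    (ℓ : ℤ_[ℓ]) ^ s ∣ tau x - 1 := by
  have h := dvd_trace_of_mem_smul_top (mem_ball_iff.1 hx)
  rw [Matrix.trace_sub, trace_eq_two_mul_tau hℓ, Matrix.trace_one, Fintype.card_fin,
    Nat.cast_ofNat, ← mul_sub_one] at h
  exact (isUnit_two hℓ).dvd_mul_left.1 h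

theorem isUnit_tau_add_one (hℓ : 2 < ℓ) {x : SL(2, ℤ_[ℓ])} (hx : x ∈ ball ℓ 1) :
    IsUnit (tau x + 1) :=
  isUnit_add_one hℓ (by simpa using dvd_tau_sub_one hℓ hx)

theorem theta₁_mem_scaledSl (hℓ : 2 < ℓ) {s : ℕ} {x : SL(2, ℤ_[ℓ])} (hx : x ∈ ball ℓ s) :
    theta₁ ℓ x ∈ scaledSl ℓ s := by
  refine mem_scaledSl.2 ⟨trace_theta₁ hℓ x, ?_⟩
  rw [← sub_eq_of_eq_add' (coe_sub_one_eq x)]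
  exact sub_mem (mem_ball_iff.1 hx) (smul_mem_smul_top_of_dvd (dvd_tau_sub_one hℓ hx) 1)

theorem mem_ball_of_theta₁_mem (hℓ : 2 < ℓ) {s : ℕ} {x : SL(2, ℤ_[ℓ])} (hx : x ∈ ball ℓ 1)
    (h : theta₁ ℓ x ∈ (ℓ : ℤ_[ℓ]) ^ s • (⊤ : Submodule ℤ_[ℓ] (Mat ℓ))) : x ∈ ball ℓ s := by
  have htau : (ℓ : ℤ_[ℓ]) ^ s ∣ tau x - 1 := by
    have hsq := mul_mem_smul_top h h
    rw [theta₁_mul_self hℓ, matrix_mem_smul_top_iff] at hsq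
    have hsq₀ : (ℓ : ℤ_[ℓ]) ^ s ∣ tau x ^ 2 - 1 :=
      (dvd_mul_right _ _).trans (by simpa using hsq 0 0)
    rwa [sq, mul_self_sub_one, (isUnit_tau_add_one hℓ hx).dvd_mul_left] at hsq₀
  rw [mem_ball_iff, coe_sub_one_eq]
  exact add_mem (smul_mem_smul_top_of_dvd htau 1) h

theorem exists_theta₁_eq (hℓ : 2 < ℓ) {s : ℕ} (hs : 0 < s) {X : Mat ℓ} (hX : X ∈ scaledSl ℓ s) :
    ∃ x ∈ ball ℓ s, theta₁ ℓ x = X := by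
  obtain ⟨htr, hdvd⟩ := mem_scaledSl.1 hX
  obtain ⟨t, ht, ht1⟩ := exists_sq_eq hℓ hs (u := 1 - X.det) (by
    rw [sub_sub_cancel_left, dvd_neg]
    exact dvd_det_of_mem_smul_top hdvd)
  have hdet : (t • (1 : Mat ℓ) + X).det = 1 := by
    rw [det_smul_one_add, ht, htr]
    ring
  obtain ⟨x, hx⟩ : ∃ x : SL(2, ℤ_[ℓ]), (x : Mat ℓ) = t • 1 + X := ⟨⟨_, hdet⟩, rfl⟩
  obtain ⟨htau, htheta⟩ := tau_eq_and_theta₁_eq hℓ htr hx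
  refine ⟨x, ?_, htheta⟩
  rw [mem_ball_iff, coe_sub_one_eq, htau, htheta]
  exact add_mem (smul_mem_smul_top_of_dvd ht1 1) hdvd

end Theta

section Openness

/-- `ℓ ^ k 𝔰𝔩₂(ℤ_ℓ) ⊕ ℓ ^ k 𝔰𝔩₂(ℤ_ℓ)`. -/
noncomputable abbrev scaledSl₂ (ℓ : ℕ) [Fact ℓ.Prime] (k : ℕ) : Submodule ℤ_[ℓ] (MatPair ℓ) :=
  (scaledSl ℓ k).prod (scaledSl ℓ k)

theorem exists_lie_add_lie_eq {K : Type*} [CommRing K] {h : K} (hh : h * 2 = 1)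
    {Z : Matrix (Fin 2) (Fin 2) K} (hZ : Z.trace = 0) :
    ∃ X Y X' Y' : Matrix (Fin 2) (Fin 2) K, X.trace = 0 ∧ Y.trace = 0 ∧ X'.trace = 0 ∧
      Y'.trace = 0 ∧ ⁅X, Y⁆ + ⁅X', Y'⁆ = Z := by
  obtain ⟨a, b, c, rfl⟩ := exists_eq_of_trace_eq_zero hZ
  refine ⟨!![0, a; 0, 0], !![0, 0; 1, 0], !![h, 0; 0, -h], !![0, b; -c, 0],
    by simp, by simp, by simp, by simp, ?_⟩
  simp only [Ring.lie_def]
  ext i j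
  fin_cases i <;> fin_cases j <;> simp
  · linear_combination b * hh
  · linear_combination c * hh

theorem scaledSl_add_le (hℓ : 2 < ℓ) {a b : ℕ} {P : Submodule ℤ_[ℓ] (Mat ℓ)}
    (h : ∀ X ∈ scaledSl ℓ a, ∀ Y ∈ scaledSl ℓ b, ⁅X, Y⁆ ∈ P) : scaledSl ℓ (a + b) ≤ P := by
  rintro _ ⟨Z, hZ, rfl⟩
  obtain ⟨X, Y, X', Y', hX, hY, hX', hY', rfl⟩ := exists_lie_add_lie_eq (half_mul_two hℓ) hZ
  have hsmul {X Y : Mat ℓ} (hX : X.trace = 0) (hY : Y.trace = 0) :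
      (ℓ : ℤ_[ℓ]) ^ (a + b) • ⁅X, Y⁆ ∈ P := by
    rw [pow_add, ← smul_smul, ← lie_smul, ← smul_lie]
    exact h _ (pow_smul_mem_scaledSl hX) _ (pow_smul_mem_scaledSl hY)
  change (ℓ : ℤ_[ℓ]) ^ (a + b) • (⁅X, Y⁆ + ⁅X', Y'⁆) ∈ P
  rw [smul_add]
  exact add_mem (hsmul hX hY) (hsmul hX' hY')

variable {M : Submodule ℤ_[ℓ] (MatPair ℓ)} {a b j : ℕ}

theorem map_inl_scaledSl_le_lieSeries_succ (hℓ : 2 < ℓ)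
    (hM : scaledSl ℓ a ≤ M.map (LinearMap.fst ℤ_[ℓ] (Mat ℓ) (Mat ℓ)))
    (hb : (scaledSl ℓ b).map (LinearMap.inl ℤ_[ℓ] (Mat ℓ) (Mat ℓ)) ≤ lieSeries M j) :
    (scaledSl ℓ (a + b)).map (LinearMap.inl ℤ_[ℓ] (Mat ℓ) (Mat ℓ)) ≤ lieSeries M (j + 1) := by
  refine Submodule.map_le_iff_le_comap.2 (scaledSl_add_le hℓ fun _ hX Y hY => ?_)
  obtain ⟨⟨X, X'⟩, hXM, rfl⟩ := hM hX
  have h := lie_mem_lieSeries_succ hXM (hb (Submodule.mem_map_of_mem hY))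
  have hlie : ⁅(X, X'), LinearMap.inl ℤ_[ℓ] (Mat ℓ) (Mat ℓ) Y⁆ = (⁅X, Y⁆, 0) :=
    Prod.ext rfl (lie_zero X')
  rwa [hlie] at h

theorem map_inr_scaledSl_le_lieSeries_succ (hℓ : 2 < ℓ)
    (hM : scaledSl ℓ a ≤ M.map (LinearMap.snd ℤ_[ℓ] (Mat ℓ) (Mat ℓ)))
    (hb : (scaledSl ℓ b).map (LinearMap.inr ℤ_[ℓ] (Mat ℓ) (Mat ℓ)) ≤ lieSeries M j) :
    (scaledSl ℓ (a + b)).map (LinearMap.inr ℤ_[ℓ] (Mat ℓ) (Mat ℓ)) ≤ lieSeries M (j + 1) := by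
  refine Submodule.map_le_iff_le_comap.2 (scaledSl_add_le hℓ fun _ hX Y hY => ?_)
  obtain ⟨⟨X', X⟩, hXM, rfl⟩ := hM hX
  have h := lie_mem_lieSeries_succ hXM (hb (Submodule.mem_map_of_mem hY))
  have hlie : ⁅(X', X), LinearMap.inr ℤ_[ℓ] (Mat ℓ) (Mat ℓ) Y⁆ = (0, ⁅X, Y⁆) :=
    Prod.ext (lie_zero X') rfl
  rwa [hlie] at h

theorem scaledSl₂_le_lieSeries_succ (hℓ : 2 < ℓ) (hM : scaledSl₂ ℓ a ≤ M)
    (hb : scaledSl₂ ℓ b ≤ lieSeries M j) : scaledSl₂ ℓ (a + b) ≤ lieSeries M (j + 1) := by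
  rw [Submodule.prod_le_iff] at hb ⊢
  exact ⟨map_inl_scaledSl_le_lieSeries_succ hℓ
      (fun X hX => ⟨(X, 0), hM ⟨hX, zero_mem _⟩, rfl⟩) hb.1,
    map_inr_scaledSl_le_lieSeries_succ hℓ
      (fun X hX => ⟨(0, X), hM ⟨zero_mem _, hX⟩, rfl⟩) hb.2⟩

variable {Γ : Subgroup (SLpair ℓ)}

theorem theta₂_mem_lieAlg {x : SLpair ℓ} (hx : x ∈ Γ) : theta₂ ℓ x ∈ lieAlg ℓ Γ :=
  Submodule.subset_span ⟨x, hx, rfl⟩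

theorem scaledSl₂_le_lieAlg (hℓ : 2 < ℓ) {s : ℕ} (hs : 0 < s) (hΓ : ball₂ ℓ s s ≤ Γ) :
    scaledSl₂ ℓ s ≤ lieAlg ℓ Γ := by
  rintro ⟨X, Y⟩ ⟨hX, hY⟩
  obtain ⟨x, hx, rfl⟩ := exists_theta₁_eq hℓ hs hX
  obtain ⟨y, hy, rfl⟩ := exists_theta₁_eq hℓ hs hY
  exact theta₂_mem_lieAlg (x := (x, y)) (hΓ (mem_ball₂.2 ⟨hx, hy⟩))

theorem exists_scaledSl₂_le_lieSeries (hℓ : 2 < ℓ) (hΓ : IsOpen (Γ : Set (SLpair ℓ))) (j : ℕ) :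
    ∃ t, scaledSl₂ ℓ t ≤ lieSeries (lieAlg ℓ Γ) j := by
  obtain ⟨s, hs⟩ := exists_ball₂_le hΓ
  have hsucc := scaledSl₂_le_lieAlg hℓ s.succ_pos ((ball₂_anti s.le_succ).trans hs)
  induction j with
  | zero => exact ⟨_, hsucc⟩
  | succ j ih =>
    obtain ⟨t, ht⟩ := ih
    exact ⟨_, scaledSl₂_le_lieSeries_succ hℓ hsucc ht⟩

end Openness

section Approximation

/-- Half of the traces of the two components. -/
noncomputable def tau₂ (x : SLpair ℓ) : ℤ_[ℓ] × ℤ_[ℓ] := (tau x.1, tau x.2)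

theorem theta₂_one (hℓ : 2 < ℓ) : theta₂ ℓ 1 = 0 := Prod.ext (theta₁_one hℓ) (theta₁_one hℓ)

theorem theta₂_inv (hℓ : 2 < ℓ) (x : SLpair ℓ) : theta₂ ℓ x⁻¹ = -theta₂ ℓ x :=
  Prod.ext (theta₁_inv hℓ x.1) (theta₁_inv hℓ x.2)

theorem theta₂_mul (hℓ : 2 < ℓ) (x y : SLpair ℓ) : theta₂ ℓ (x * y) =
    scale (tau₂ x) (theta₂ ℓ y) + scale (tau₂ y) (theta₂ ℓ x) +
      Ring.inverse (2 : ℤ_[ℓ]) • ⁅theta₂ ℓ x, theta₂ ℓ y⁆ :=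
  Prod.ext (theta₁_mul hℓ x.1 y.1) (theta₁_mul hℓ x.2 y.2)

theorem theta₂_mul_sub_theta₂_mul (hℓ : 2 < ℓ) (x y : SLpair ℓ) :
    theta₂ ℓ (x * y) - theta₂ ℓ (y * x) = ⁅theta₂ ℓ x, theta₂ ℓ y⁆ :=
  Prod.ext (theta₁_mul_sub_theta₁_mul hℓ x.1 y.1) (theta₁_mul_sub_theta₁_mul hℓ x.2 y.2)

theorem theta₂_commutator (hℓ : 2 < ℓ) (x y : SLpair ℓ) :
    theta₂ ℓ ⁅x, y⁆ = scale (tau₂ (y * x)) ⁅theta₂ ℓ x, theta₂ ℓ y⁆ -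
      Ring.inverse (2 : ℤ_[ℓ]) • ⁅⁅theta₂ ℓ x, theta₂ ℓ y⁆, theta₂ ℓ (y * x)⁆ :=
  Prod.ext (theta₁_commutator hℓ x.1 y.1) (theta₁_commutator hℓ x.2 y.2)

theorem theta₂_mul_self (hℓ : 2 < ℓ) (x : SLpair ℓ) (Y : MatPair ℓ) :
    theta₂ ℓ x * theta₂ ℓ x * Y = scale (tau₂ x ^ 2 - 1) Y := by
  refine Prod.ext ?_ ?_
  · exact (congrArg (· * Y.1) (theta₁_mul_self hℓ x.1)).trans (smul_one_mul _ _)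
  · exact (congrArg (· * Y.2) (theta₁_mul_self hℓ x.2)).trans (smul_one_mul _ _)

theorem scale_eq_add_scale_sub_one (c : ℤ_[ℓ] × ℤ_[ℓ]) (Y : MatPair ℓ) :
    scale c Y = Y + scale (c - 1) Y := by
  ext1 <;> simp only [scale_apply, Prod.fst_add, Prod.snd_add, Prod.fst_sub, Prod.snd_sub,
    Prod.fst_one, Prod.snd_one] <;> module

theorem mem_scaledSl₂_zero {X : MatPair ℓ} :
    X ∈ scaledSl₂ ℓ 0 ↔ X.1.trace = 0 ∧ X.2.trace = 0 := by
  rw [Submodule.mem_prod, mem_scaledSl_zero, mem_scaledSl_zero]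

theorem lie_mem_scaledSl₂_zero {X Y : MatPair ℓ} : ⁅X, Y⁆ ∈ scaledSl₂ ℓ 0 :=
  mem_scaledSl₂_zero.2 ⟨LieAlgebra.matrix_trace_commutator_zero (Fin 2) ℤ_[ℓ] X.1 Y.1,
    LieAlgebra.matrix_trace_commutator_zero (Fin 2) ℤ_[ℓ] X.2 Y.2⟩

theorem anticommutator_mem_center {X Y : MatPair ℓ} (hX : X ∈ scaledSl₂ ℓ 0)
    (hY : Y ∈ scaledSl₂ ℓ 0) : X * Y + Y * X ∈ Subring.center (MatPair ℓ) := by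
  rw [mem_scaledSl₂_zero] at hX hY
  have hXY : X * Y + Y * X = ((X.1 * Y.1).trace • 1, (X.2 * Y.2).trace • 1) :=
    Prod.ext (anticommutator_eq_trace_smul_one hX.1 hY.1)
      (anticommutator_eq_trace_smul_one hX.2 hY.2)
  rw [hXY, Subring.mem_center_iff]
  exact fun Z => Prod.ext (by simp) (by simp)

variable {Γ : Subgroup (SLpair ℓ)}

theorem lieAlg_le_scaledSl₂_zero (hℓ : 2 < ℓ) : lieAlg ℓ Γ ≤ scaledSl₂ ℓ 0 := by
  refine Submodule.span_le.2 ?_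
  rintro _ ⟨x, -, rfl⟩
  exact mem_scaledSl₂_zero.2 ⟨trace_theta₁ hℓ x.1, trace_theta₁ hℓ x.2⟩

theorem lieAlg_le_smul_top (hℓ : 2 < ℓ) (hΓ : Γ ≤ ball₂ ℓ 1 1) :
    lieAlg ℓ Γ ≤ (ℓ : ℤ_[ℓ]) • ⊤ := by
  refine Submodule.span_le.2 ?_
  rintro _ ⟨x, hx, rfl⟩
  obtain ⟨X, hX⟩ := (mem_scaledSl.1 (theta₁_mem_scaledSl hℓ (hΓ hx).1)).2
  obtain ⟨Y, hY⟩ := (mem_scaledSl.1 (theta₁_mem_scaledSl hℓ (hΓ hx).2)).2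
  rw [pow_one] at hX hY
  exact mem_smul_top_iff.2 ⟨(X, Y), Prod.ext hX.2 hY.2⟩

theorem lieSeries_one_lieAlg_eq_span : lieSeries (lieAlg ℓ Γ) 1 =
    Submodule.span ℤ_[ℓ] (Set.image2 (fun X Y => ⁅X, Y⁆) (theta₂ ℓ '' Γ) (theta₂ ℓ '' Γ)) :=
  lieSeries_succ_eq_span rfl rfl

theorem lieSeries_lieAlg_antitone (hℓ : 2 < ℓ) : Antitone (lieSeries (lieAlg ℓ Γ)) := by
  suffices h : lieSeries (lieAlg ℓ Γ) 1 ≤ lieAlg ℓ Γ from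
    lieSeries_antitone (lieSeries_succ_le_iff.1 h)
  rw [lieSeries_one_lieAlg_eq_span, Submodule.span_le]
  rintro _ ⟨_, ⟨x, hx, rfl⟩, _, ⟨y, hy, rfl⟩, rfl⟩
  dsimp only
  rw [← theta₂_mul_sub_theta₂_mul hℓ]
  exact sub_mem (theta₂_mem_lieAlg (mul_mem hx hy)) (theta₂_mem_lieAlg (mul_mem hy hx))

theorem scale_tau₂_sub_one_mem (hℓ : 2 < ℓ) {x : SLpair ℓ} (hx : x ∈ ball₂ ℓ 1 1)
    (hxΓ : theta₂ ℓ x ∈ lieAlg ℓ Γ) {j : ℕ} {Y : MatPair ℓ}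
    (hY : Y ∈ lieSeries (lieAlg ℓ Γ) (j + 1)) :
    scale (tau₂ x - 1) Y ∈ lieSeries (lieAlg ℓ Γ) (j + 3) := by
  have h₁ : (ℓ : ℤ_[ℓ]) ∣ tau x.1 - 1 := by simpa using dvd_tau_sub_one hℓ hx.1
  have h₂ : (ℓ : ℤ_[ℓ]) ∣ tau x.2 - 1 := by simpa using dvd_tau_sub_one hℓ hx.2
  have h₁₂ : IsUnit (tau x.1 + tau x.2) :=
    isUnit_of_dvd_sub (isUnit_two hℓ) (by convert dvd_add h₁ h₂ using 1; ring)
  refine scale_sub_one_mem (lieSeries_lieAlg_antitone hℓ (by omega : j + 1 ≤ j + 3))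
    (isUnit_add_one hℓ h₁) (isUnit_add_one hℓ h₂) h₁₂ (fun Y hY => ?_) hY
  have h := anticommutator_mul_mem_lieSeries (isUnit_two hℓ) (lieAlg_le_scaledSl₂_zero hℓ)
    (fun _ _ _ _ => lie_mem_scaledSl₂_zero) (fun _ hX _ hY => anticommutator_mem_center hX hY)
    hxΓ hxΓ hY
  rwa [← two_smul ℤ_[ℓ], smul_mul_assoc, Submodule.smul_mem_iff_of_isUnit _ (isUnit_two hℓ),
    theta₂_mul_self hℓ] at h

theorem theta₂_mul_sub_add_mem (hℓ : 2 < ℓ) {x y : SLpair ℓ} (hx : x ∈ ball₂ ℓ 1 1)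
    (hy : y ∈ ball₂ ℓ 1 1) {j : ℕ} (hxj : theta₂ ℓ x ∈ lieSeries (lieAlg ℓ Γ) (j + 1))
    (hyj : theta₂ ℓ y ∈ lieSeries (lieAlg ℓ Γ) (j + 1)) :
    theta₂ ℓ (x * y) - (theta₂ ℓ x + theta₂ ℓ y) ∈ lieSeries (lieAlg ℓ Γ) (j + 2) := by
  have anti := lieSeries_lieAlg_antitone (Γ := Γ) hℓ
  have h₁ := scale_tau₂_sub_one_mem hℓ hx (anti (Nat.zero_le _) hxj) hyj
  have h₂ := scale_tau₂_sub_one_mem hℓ hy (anti (Nat.zero_le _) hyj) hxj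
  have h₃ := lie_mem_lieSeries rfl hxj hyj
  have hexpand : theta₂ ℓ (x * y) - (theta₂ ℓ x + theta₂ ℓ y) =
      scale (tau₂ x - 1) (theta₂ ℓ y) + scale (tau₂ y - 1) (theta₂ ℓ x) +
      Ring.inverse (2 : ℤ_[ℓ]) • ⁅theta₂ ℓ x, theta₂ ℓ y⁆ := by
    rw [theta₂_mul hℓ, scale_eq_add_scale_sub_one, scale_eq_add_scale_sub_one (tau₂ y)]
    abel
  rw [hexpand]
  exact add_mem (add_mem (anti (by omega) h₁) (anti (by omega) h₂))
    (Submodule.smul_mem _ _ (anti (by omega) h₃))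

theorem theta₂_commutator_sub_mem (hℓ : 2 < ℓ) (hΓ : Γ ≤ ball₂ ℓ 1 1) {x y : SLpair ℓ}
    (hx : x ∈ Γ) (hy : y ∈ Γ) {j : ℕ} (hyj : theta₂ ℓ y ∈ lieSeries (lieAlg ℓ Γ) j) :
    theta₂ ℓ ⁅x, y⁆ - ⁅theta₂ ℓ x, theta₂ ℓ y⁆ ∈ lieSeries (lieAlg ℓ Γ) (j + 2) := by
  have hyx := mul_mem hy hx
  have hlie := lie_mem_lieSeries_succ (theta₂_mem_lieAlg hx) hyj
  rw [theta₂_commutator hℓ, scale_eq_add_scale_sub_one, add_sub_assoc, add_sub_cancel_left]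
  exact sub_mem
    (lieSeries_lieAlg_antitone hℓ (by omega)
      (scale_tau₂_sub_one_mem hℓ (hΓ hyx) (theta₂_mem_lieAlg hyx) hlie))
    (Submodule.smul_mem _ _ (lie_mem_lieSeries (j := 0) rfl hlie (theta₂_mem_lieAlg hyx)))

/-- `X` lies in `L_j` and agrees modulo `L_{j+1}` with the image under `Θ₂` of an element of `Γ`,
where `L` is the descending central series of `𝓛(Γ)`. -/
def IsApproximable (Γ : Subgroup (SLpair ℓ)) (j : ℕ) (X : MatPair ℓ) : Prop :=
  X ∈ lieSeries (lieAlg ℓ Γ) j ∧ ∃ γ ∈ Γ, theta₂ ℓ γ - X ∈ lieSeries (lieAlg ℓ Γ) (j + 1)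

theorem theta₂_mem_lieSeries_of_sub_mem (hℓ : 2 < ℓ) {j : ℕ} {X : MatPair ℓ} {γ : SLpair ℓ}
    (hX : X ∈ lieSeries (lieAlg ℓ Γ) j) (hγ : theta₂ ℓ γ - X ∈ lieSeries (lieAlg ℓ Γ) (j + 1)) :
    theta₂ ℓ γ ∈ lieSeries (lieAlg ℓ Γ) j := by
  simpa using add_mem (lieSeries_lieAlg_antitone hℓ j.le_succ hγ) hX

namespace IsApproximable

theorem of_mem_succ (hℓ : 2 < ℓ) {j : ℕ} {X : MatPair ℓ}
    (hX : X ∈ lieSeries (lieAlg ℓ Γ) (j + 1)) : IsApproximable Γ j X :=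
  ⟨lieSeries_lieAlg_antitone hℓ j.le_succ hX, 1, one_mem Γ, by
    rw [theta₂_one hℓ, zero_sub]
    exact neg_mem hX⟩

theorem add (hℓ : 2 < ℓ) (hΓ : Γ ≤ ball₂ ℓ 1 1) {j : ℕ} {X Y : MatPair ℓ}
    (hX : IsApproximable Γ (j + 1) X) (hY : IsApproximable Γ (j + 1) Y) :
    IsApproximable Γ (j + 1) (X + Y) := by
  obtain ⟨hX, γ, hγ, hγX⟩ := hX
  obtain ⟨hY, δ, hδ, hδY⟩ := hY
  refine ⟨add_mem hX hY, γ * δ, mul_mem hγ hδ, ?_⟩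
  have h := theta₂_mul_sub_add_mem hℓ (hΓ hγ) (hΓ hδ) (theta₂_mem_lieSeries_of_sub_mem hℓ hX hγX)
    (theta₂_mem_lieSeries_of_sub_mem hℓ hY hδY)
  convert add_mem h (add_mem hγX hδY) using 1
  abel

theorem nsmul (hℓ : 2 < ℓ) (hΓ : Γ ≤ ball₂ ℓ 1 1) {j : ℕ} {X : MatPair ℓ}
    (hX : IsApproximable Γ (j + 1) X) (k : ℕ) : IsApproximable Γ (j + 1) (k • X) := by
  induction k with
  | zero =>
    rw [zero_smul]
    exact of_mem_succ hℓ (zero_mem _)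
  | succ k ih =>
    rw [succ_nsmul]
    exact ih.add hℓ hΓ hX

-- Every scalar is a natural number modulo a power of `ℓ` that kills `X` modulo `L_{j+2}`.
theorem smul (hℓ : 2 < ℓ) (hΓ : Γ ≤ ball₂ ℓ 1 1) (hopen : IsOpen (Γ : Set (SLpair ℓ))) {j : ℕ}
    {X : MatPair ℓ} (hX : IsApproximable Γ (j + 1) X) (c : ℤ_[ℓ]) :
    IsApproximable Γ (j + 1) (c • X) := by
  obtain ⟨t, ht⟩ := exists_scaledSl₂_le_lieSeries hℓ hopen (j + 2)
  obtain ⟨d, hd⟩ := Ideal.mem_span_singleton.1 (PadicInt.appr_spec t c)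
  have hX₀ := lieSeries_le (lieAlg_le_scaledSl₂_zero hℓ)
    (fun _ _ _ _ => lie_mem_scaledSl₂_zero) _ hX.1
  have hsmall : (ℓ : ℤ_[ℓ]) ^ t • d • X ∈ scaledSl₂ ℓ t := by
    rw [mem_scaledSl₂_zero] at hX₀
    rw [smul_comm]
    exact Submodule.smul_mem _ d ⟨pow_smul_mem_scaledSl hX₀.1, pow_smul_mem_scaledSl hX₀.2⟩
  have hc : c • X = c.appr t • X + (ℓ : ℤ_[ℓ]) ^ t • d • X := by
    rw [smul_smul, ← hd, ← Nat.cast_smul_eq_nsmul ℤ_[ℓ], ← add_smul, add_sub_cancel]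
  rw [hc]
  exact (hX.nsmul hℓ hΓ _).add hℓ hΓ (of_mem_succ hℓ (ht hsmall))

theorem lie (hℓ : 2 < ℓ) (hΓ : Γ ≤ ball₂ ℓ 1 1) {x : SLpair ℓ} (hx : x ∈ Γ) {j : ℕ}
    {Y : MatPair ℓ} (hY : IsApproximable Γ j Y) : IsApproximable Γ (j + 1) ⁅theta₂ ℓ x, Y⁆ := by
  obtain ⟨hY, y, hy, hyY⟩ := hY
  have hxΓ := theta₂_mem_lieAlg hx
  refine ⟨lie_mem_lieSeries_succ hxΓ hY, ⁅x, y⁆,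
    mul_mem (mul_mem (mul_mem hx hy) (inv_mem hx)) (inv_mem hy), ?_⟩
  have h₁ := theta₂_commutator_sub_mem hℓ hΓ hx hy (theta₂_mem_lieSeries_of_sub_mem hℓ hY hyY)
  have h₂ := lie_mem_lieSeries_succ hxΓ hyY
  rw [lie_sub] at h₂
  convert add_mem h₁ h₂ using 1
  abel

theorem of_mem_lieSeries_succ (hℓ : 2 < ℓ) (hΓ : Γ ≤ ball₂ ℓ 1 1)
    (hopen : IsOpen (Γ : Set (SLpair ℓ))) {j : ℕ} {B : Set (MatPair ℓ)}
    (hB : Submodule.span ℤ_[ℓ] B = lieSeries (lieAlg ℓ Γ) j)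
    (happrox : ∀ Y ∈ B, IsApproximable Γ j Y) {X : MatPair ℓ}
    (hX : X ∈ lieSeries (lieAlg ℓ Γ) (j + 1)) : IsApproximable Γ (j + 1) X := by
  rw [lieSeries_succ_eq_span (M := lieAlg ℓ Γ) rfl hB] at hX
  induction hX using Submodule.span_induction with
  | zero => exact of_mem_succ hℓ (zero_mem _)
  | add X Y _ _ hX hY => exact hX.add hℓ hΓ hY
  | smul c X _ hX => exact hX.smul hℓ hΓ hopen c
  | mem _ h =>
    obtain ⟨_, ⟨x, hx, rfl⟩, Y, hY, rfl⟩ := h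
    exact (happrox Y hY).lie hℓ hΓ hx

end IsApproximable

theorem isApproximable_of_mem_lieSeries (hℓ : 2 < ℓ) (hΓ : Γ ≤ ball₂ ℓ 1 1)
    (hopen : IsOpen (Γ : Set (SLpair ℓ))) {j : ℕ} {X : MatPair ℓ}
    (hX : X ∈ lieSeries (lieAlg ℓ Γ) (j + 1)) : IsApproximable Γ (j + 1) X := by
  induction j generalizing X with
  | zero =>
    refine .of_mem_lieSeries_succ hℓ hΓ hopen (j := 0) (B := theta₂ ℓ '' Γ) rfl ?_ hX
    rintro _ ⟨x, hx, rfl⟩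
    refine ⟨theta₂_mem_lieAlg hx, x, hx, ?_⟩
    rw [sub_self]
    exact zero_mem _
  | succ j ih =>
    exact .of_mem_lieSeries_succ hℓ hΓ hopen (Submodule.span_eq _) (fun Y hY => ih hY) hX

theorem exists_mul_mem_lieSeries (hℓ : 2 < ℓ) (hΓ : Γ ≤ ball₂ ℓ 1 1)
    (hopen : IsOpen (Γ : Set (SLpair ℓ))) {h : SLpair ℓ} (hh : h ∈ ball₂ ℓ 1 1)
    (hθ : theta₂ ℓ h ∈ lieSeries (lieAlg ℓ Γ) 1) (j : ℕ) :
    ∃ γ ∈ Γ, theta₂ ℓ (γ * h) ∈ lieSeries (lieAlg ℓ Γ) (j + 1) := by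
  induction j with
  | zero => exact ⟨1, one_mem Γ, by rwa [one_mul]⟩
  | succ j ih =>
    obtain ⟨γ, hγ, hγh⟩ := ih
    obtain ⟨-, δ, hδ, hδh⟩ := isApproximable_of_mem_lieSeries hℓ hΓ hopen hγh
    refine ⟨δ⁻¹ * γ, mul_mem (inv_mem hδ) hγ, ?_⟩
    have hδj : theta₂ ℓ δ⁻¹ ∈ lieSeries (lieAlg ℓ Γ) (j + 1) := by
      rw [theta₂_inv hℓ]
      exact neg_mem (theta₂_mem_lieSeries_of_sub_mem hℓ hγh hδh)
    have hmul := theta₂_mul_sub_add_mem hℓ (inv_mem (hΓ hδ)) (mul_mem (hΓ hγ) hh) hδj hγh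
    rw [mul_assoc]
    convert sub_mem hmul hδh using 1
    rw [theta₂_inv hℓ]
    abel

theorem mem_of_theta₂_mem (hℓ : 2 < ℓ) (hΓ : Γ ≤ ball₂ ℓ 1 1)
    (hopen : IsOpen (Γ : Set (SLpair ℓ))) {h : SLpair ℓ} (hh : h ∈ ball₂ ℓ 1 1)
    (hθ : theta₂ ℓ h ∈ lieSeries (lieAlg ℓ Γ) 1) : h ∈ Γ := by
  obtain ⟨s, hs⟩ := exists_ball₂_le hopen
  obtain ⟨γ, hγ, hγh⟩ := exists_mul_mem_lieSeries hℓ hΓ hopen hh hθ s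
  obtain ⟨Y, hY⟩ := mem_smul_top_iff.1
    (lieSeries_le_pow_smul_top (lieAlg_le_smul_top hℓ hΓ) _ hγh)
  have hball := mul_mem (hΓ hγ) hh
  have hdvd : (ℓ : ℤ_[ℓ]) ^ s ∣ (ℓ : ℤ_[ℓ]) ^ (s + 1 + 1) := pow_dvd_pow _ (by omega)
  refine (Subgroup.mul_mem_cancel_left _ hγ).1 (hs (mem_ball₂.2 ⟨?_, ?_⟩))
  · refine mem_ball_of_theta₁_mem hℓ hball.1 ?_
    exact mem_smul_top_of_dvd hdvd (mem_smul_top_iff.2 ⟨Y.1, congrArg Prod.fst hY⟩)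
  · refine mem_ball_of_theta₁_mem hℓ hball.2 ?_
    exact mem_smul_top_of_dvd hdvd (mem_smul_top_iff.2 ⟨Y.2, congrArg Prod.snd hY⟩)

end Approximation

section Unipotents

variable {K : Type*} [CommRing K] {V : Matrix (Fin 2) (Fin 2) K}

theorem mul_self_eq_zero_of_trace_det_eq_zero (htr : V.trace = 0) (hdet : V.det = 0) :
    V * V = 0 := by
  have h := V.mul_adjugate
  rwa [adjugate_eq_trace_smul_one_sub, htr, hdet, zero_smul, zero_sub, mul_neg, neg_eq_zero]
    at h

theorem det_one_add_smul (htr : V.trace = 0) (hdet : V.det = 0) (c : K) :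
    (1 + c • V).det = 1 := by
  have h := det_smul_one_add 1 (c • V)
  rwa [one_smul, Matrix.trace_smul, htr, Matrix.det_smul, hdet, smul_zero, mul_zero, mul_zero,
    add_zero, add_zero, one_pow] at h

theorem one_add_pow_of_mul_self_eq_zero {R : Type*} [Ring R] {x : R} (hx : x * x = 0) (k : ℕ) :
    (1 + x) ^ k = 1 + k • x := by
  induction k with
  | zero => simp
  | succ k ih =>
    rw [pow_succ, ih, add_mul, mul_add, smul_mul_assoc, mul_add, hx, succ_nsmul]
    simp only [mul_one, one_mul, add_zero]
    abel

theorem mem_span_nilpotent {X : Matrix (Fin 2) (Fin 2) K} (hX : X.trace = 0) :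
    X ∈ Submodule.span K {V : Matrix (Fin 2) (Fin 2) K | V.trace = 0 ∧ V.det = 0} := by
  obtain ⟨a, b, c, rfl⟩ := exists_eq_of_trace_eq_zero hX
  have hsum : !![a, b; c, -a] =
      (-a) • !![-1, 1; -1, 1] + (b + a) • !![0, 1; 0, 0] + (c - a) • !![0, 0; 1, 0] := by
    ext i j
    fin_cases i <;> fin_cases j <;> simp
  rw [hsum]
  refine add_mem (add_mem ?_ ?_) ?_ <;>
    exact Submodule.smul_mem _ _ (Submodule.subset_span (by simp [Matrix.det_fin_two]))

variable {P : Type*} [Group P] {H H' : Subgroup P} {p : P →* SL(2, K)} {c d : K}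

/-- Every unipotent matrix `1 + c • V`, with `V` of trace and determinant zero, is the image
under `p` of an element of `H`. -/
def LiftsUnipotents (H : Subgroup P) (p : P →* SL(2, K)) (c : K) : Prop :=
  ∀ V : Matrix (Fin 2) (Fin 2) K, V.trace = 0 → V.det = 0 →
    ∃ t ∈ H, (p t : Matrix (Fin 2) (Fin 2) K) = 1 + c • V

namespace LiftsUnipotents

theorem mono (h : LiftsUnipotents H p c) (hH : H ≤ H') : LiftsUnipotents H' p c :=
  fun V htr hdet => (h V htr hdet).imp fun _ ht => ⟨hH ht.1, ht.2⟩

theorem of_dvd (h : LiftsUnipotents H p c) (hcd : c ∣ d) : LiftsUnipotents H p d := by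
  obtain ⟨b, rfl⟩ := hcd
  intro V htr hdet
  rw [mul_smul]
  exact h (b • V) (by rw [Matrix.trace_smul, htr, smul_zero])
    (by rw [Matrix.det_smul, hdet, mul_zero])

theorem pow {k : ℕ} (h : LiftsUnipotents H p c) (hk : ∀ t ∈ H, t ^ k ∈ H') :
    LiftsUnipotents H' p (k * c) := by
  intro V htr hdet
  obtain ⟨t, ht, htV⟩ := h V htr hdet
  refine ⟨t ^ k, hk t ht, ?_⟩
  rw [map_pow, Matrix.SpecialLinearGroup.coe_pow, htV, one_add_pow_of_mul_self_eq_zero,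
    mul_smul, Nat.cast_smul_eq_nsmul]
  rw [smul_mul_smul_comm, mul_self_eq_zero_of_trace_det_eq_zero htr hdet, smul_zero]

end LiftsUnipotents

theorem liftsUnipotents_of_ball_le {H : Subgroup P} {p : P →* SL(2, ℤ_[ℓ])} {n : ℕ}
    (hH : ball ℓ n ≤ H.map p) : LiftsUnipotents H p ((ℓ : ℤ_[ℓ]) ^ n) := by
  intro V htr hdet
  obtain ⟨g, hg⟩ : ∃ g : SL(2, ℤ_[ℓ]), (g : Mat ℓ) = 1 + (ℓ : ℤ_[ℓ]) ^ n • V :=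
    ⟨⟨_, det_one_add_smul htr hdet _⟩, rfl⟩
  obtain ⟨t, ht, rfl⟩ := hH (mem_ball_iff.2 (by
    rw [hg, add_sub_cancel_left]
    exact smul_mem_smul_top _ V) : g ∈ ball ℓ n)
  exact ⟨t, ht, hg⟩

theorem pow_card_mem_ball_one (x : SL(2, ℤ_[ℓ])) :
    x ^ (ℓ * ((ℓ ^ 2 - 1) * (ℓ - 1))) ∈ ball ℓ 1 := by
  have hcard : Nat.card (GL (Fin 2) (ZMod ℓ)) = ℓ * ((ℓ ^ 2 - 1) * (ℓ - 1)) := by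
    have hfactor : ℓ ^ 2 - ℓ ^ 1 = ℓ * (ℓ - 1) := by rw [Nat.mul_sub, mul_one, pow_one, pow_two]
    rw [Matrix.card_GL_field, Fin.prod_univ_two, ZMod.card, Fin.val_zero, Fin.val_one, hfactor,
      pow_zero]
    ring
  rw [mem_ball_one_iff, map_pow, ← hcard]
  apply Matrix.SpecialLinearGroup.toGL_injective
  rw [map_pow, map_one, pow_card_eq_one']

theorem not_dvd_card_factor (hℓ : 2 < ℓ) : ¬ ℓ ∣ (ℓ ^ 2 - 1) * (ℓ - 1) := by
  have hp : ℓ.Prime := Fact.out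
  rw [hp.dvd_mul, not_or]
  refine ⟨fun h => ?_, Nat.not_dvd_of_pos_of_lt (by omega) (by omega)⟩
  have hone := (Nat.dvd_sub_iff_right (Nat.one_le_pow _ _ hp.pos) (dvd_pow_self ℓ two_ne_zero)).1 h
  exact hp.one_lt.ne' (Nat.dvd_one.1 hone)

-- The order of `GL₂(𝔽_ℓ)` is `ℓ` times an `ℓ`-adic unit, so that raising a lift of a unipotent
-- matrix to this power brings it into `𝓑_ℓ(1, 1)` at the cost of a single factor `ℓ`.
theorem LiftsUnipotents.inf_ball₂ (hℓ : 2 < ℓ) {G : Subgroup (SLpair ℓ)}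
    {p : SLpair ℓ →* SL(2, ℤ_[ℓ])} {n : ℕ} (h : LiftsUnipotents G p ((ℓ : ℤ_[ℓ]) ^ n)) :
    LiftsUnipotents (G ⊓ ball₂ ℓ 1 1) p ((ℓ : ℤ_[ℓ]) ^ (n + 1)) := by
  have hpow : ∀ t ∈ G, t ^ (ℓ * ((ℓ ^ 2 - 1) * (ℓ - 1))) ∈ G ⊓ ball₂ ℓ 1 1 := fun t ht =>
    ⟨pow_mem ht _, mem_ball₂.2 ⟨pow_card_mem_ball_one t.1, pow_card_mem_ball_one t.2⟩⟩
  refine (h.pow hpow).of_dvd ?_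
  rw [pow_succ' (ℓ : ℤ_[ℓ]), Nat.cast_mul]
  exact mul_dvd_mul_right ((isUnit_natCast (not_dvd_card_factor hℓ)).mul_right_dvd.2 dvd_rfl) _

end Unipotents

section Projections

variable {Γ : Subgroup (SLpair ℓ)} {p : SLpair ℓ →* SL(2, ℤ_[ℓ])}
  {q : MatPair ℓ →ₗ[ℤ_[ℓ]] Mat ℓ} {m : ℕ}

theorem scaledSl_le_of_forall_nilpotent {W : Submodule ℤ_[ℓ] (Mat ℓ)}
    (hW : ∀ V : Mat ℓ, V.trace = 0 → V.det = 0 → (ℓ : ℤ_[ℓ]) ^ m • V ∈ W) :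
    scaledSl ℓ m ≤ W := by
  rintro _ ⟨X, hX, rfl⟩
  have hle : Submodule.span ℤ_[ℓ] {V : Mat ℓ | V.trace = 0 ∧ V.det = 0} ≤
      W.comap (LinearMap.lsmul ℤ_[ℓ] (Mat ℓ) ((ℓ : ℤ_[ℓ]) ^ m)) :=
    Submodule.span_le.2 fun V hV => hW V hV.1 hV.2
  exact hle (mem_span_nilpotent hX)

theorem scaledSl_le_map_lieAlg (hℓ : 2 < ℓ) (hpq : ∀ z, q (theta₂ ℓ z) = theta₁ ℓ (p z))
    (hΓ : LiftsUnipotents Γ p ((ℓ : ℤ_[ℓ]) ^ m)) : scaledSl ℓ m ≤ (lieAlg ℓ Γ).map q := by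
  refine scaledSl_le_of_forall_nilpotent fun V htr hdet => ?_
  obtain ⟨z, hz, hzV⟩ := hΓ V htr hdet
  refine ⟨theta₂ ℓ z, theta₂_mem_lieAlg hz, ?_⟩
  rw [hpq]
  exact (tau_eq_and_theta₁_eq hℓ (s := 1) (by rw [Matrix.trace_smul, htr, smul_zero])
    (by rw [hzV, one_smul])).2

/-- The inclusion of `SL₂(ℤ_ℓ)²` in `M₂(ℤ_ℓ)²`. -/
def coePair (ℓ : ℕ) [Fact ℓ.Prime] : SLpair ℓ →* MatPair ℓ where
  toFun x := (x.1, x.2)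
  map_one' := rfl
  map_mul' _ _ := rfl

/-- The subalgebra of `M₂(ℤ_ℓ)²` generated, equivalently spanned, by `Γ`. -/
noncomputable def spanAlg (Γ : Subgroup (SLpair ℓ)) : Subalgebra ℤ_[ℓ] (MatPair ℓ) :=
  Algebra.adjoin ℤ_[ℓ] (coePair ℓ '' Γ)

theorem coePair_mem_spanAlg {x : SLpair ℓ} (hx : x ∈ Γ) : coePair ℓ x ∈ spanAlg Γ :=
  Algebra.subset_adjoin ⟨x, hx, rfl⟩

theorem spanAlg_le {W : Submodule ℤ_[ℓ] (MatPair ℓ)} (hW : ∀ x ∈ Γ, coePair ℓ x ∈ W) :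
    Subalgebra.toSubmodule (spanAlg Γ) ≤ W := by
  have hclosure : (Submonoid.closure (coePair ℓ '' (Γ : Set (SLpair ℓ))) : Set (MatPair ℓ)) =
      coePair ℓ '' Γ :=
    congrArg _ (Submonoid.closure_eq (Γ.toSubmonoid.map (coePair ℓ)))
  rw [spanAlg, Algebra.adjoin_eq_span, hclosure, Submodule.span_le]
  rintro _ ⟨x, hx, rfl⟩
  exact hW x hx

theorem pow_smul_mem_of_scaledSl_le (hℓ : 2 < ℓ) {W : Submodule ℤ_[ℓ] (Mat ℓ)} (hone : 1 ∈ W)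
    (hW : scaledSl ℓ m ≤ W) (Y : Mat ℓ) : (ℓ : ℤ_[ℓ]) ^ m • Y ∈ W := by
  have htr : (Y - (Ring.inverse 2 * Y.trace) • 1).trace = 0 := by
    rw [Matrix.trace_sub, Matrix.trace_smul, Matrix.trace_one, Fintype.card_fin, smul_eq_mul,
      Nat.cast_ofNat]
    linear_combination -Y.trace * half_mul_two hℓ
  rw [← sub_add_cancel Y ((Ring.inverse 2 * Y.trace) • 1), smul_add, smul_smul]
  exact add_mem (hW (pow_smul_mem_scaledSl htr)) (Submodule.smul_mem _ _ hone)

theorem exists_mem_spanAlg_eq (hℓ : 2 < ℓ) (hpq : ∀ z, q (coePair ℓ z) = p z)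
    (hΓ : LiftsUnipotents Γ p ((ℓ : ℤ_[ℓ]) ^ m)) (Y : Mat ℓ) :
    ∃ r ∈ spanAlg Γ, q r = (ℓ : ℤ_[ℓ]) ^ m • Y := by
  have hone : q 1 = 1 := by simpa using hpq 1
  refine pow_smul_mem_of_scaledSl_le hℓ (W := (Subalgebra.toSubmodule (spanAlg Γ)).map q)
    ⟨1, one_mem (spanAlg Γ), hone⟩ (scaledSl_le_of_forall_nilpotent fun V htr hdet => ?_) Y
  obtain ⟨z, hz, hzV⟩ := hΓ V htr hdet
  refine ⟨coePair ℓ z - 1, sub_mem (coePair_mem_spanAlg hz) (one_mem (spanAlg Γ)), ?_⟩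
  rw [map_sub, hpq, hone, hzV, add_sub_cancel_left]

end Projections

section Precision

variable {Γ : Subgroup (SLpair ℓ)}

theorem tau_inv (x : SL(2, ℤ_[ℓ])) : tau x⁻¹ = tau x := by
  simp [tau, Matrix.SpecialLinearGroup.coe_inv, Matrix.adjugate_fin_two, Matrix.trace_fin_two,
    add_comm]

theorem scale_tau₂_mem_lieAlg (hℓ : 2 < ℓ) {x : SLpair ℓ} (hx : x ∈ Γ) {X : MatPair ℓ}
    (hX : X ∈ lieAlg ℓ Γ) : scale (tau₂ x) X ∈ lieAlg ℓ Γ := by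
  suffices hle : lieAlg ℓ Γ ≤ (lieAlg ℓ Γ).comap (scale (tau₂ x)) from hle hX
  refine Submodule.span_le.2 ?_
  rintro _ ⟨z, hz, rfl⟩
  have htau : tau₂ x⁻¹ = tau₂ x := Prod.ext (tau_inv x.1) (tau_inv x.2)
  have hdouble : (2 : ℤ_[ℓ]) • scale (tau₂ x) (theta₂ ℓ z) =
      theta₂ ℓ (x * z) + theta₂ ℓ (x⁻¹ * z) := by
    rw [theta₂_mul hℓ, theta₂_mul hℓ, theta₂_inv hℓ, htau, map_neg, neg_lie]
    module
  refine (Submodule.smul_mem_iff_of_isUnit (lieAlg ℓ Γ) (isUnit_two hℓ)).1 ?_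
  rw [hdouble]
  exact add_mem (theta₂_mem_lieAlg (mul_mem hx hz)) (theta₂_mem_lieAlg (mul_mem (inv_mem hx) hz))

variable {m e : ℕ} {x : SLpair ℓ} {u : ℤ_[ℓ]}

theorem map_inl_scaledSl_le_lieAlg (hℓ : 2 < ℓ)
    (hm : scaledSl ℓ m ≤ (lieAlg ℓ Γ).map (LinearMap.fst ℤ_[ℓ] (Mat ℓ) (Mat ℓ)))
    (hx : x ∈ Γ) (hu : IsUnit u) (he : tau x.1 - tau x.2 = (ℓ : ℤ_[ℓ]) ^ e * u) :
    (scaledSl ℓ (e + m)).map (LinearMap.inl ℤ_[ℓ] (Mat ℓ) (Mat ℓ)) ≤ lieAlg ℓ Γ := by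
  rintro _ ⟨_, ⟨Y, hY, rfl⟩, rfl⟩
  obtain ⟨Z, hZ, hZY⟩ := hm (pow_smul_mem_scaledSl hY)
  have hmem := sub_mem (scale_tau₂_mem_lieAlg hℓ hx hZ) (Submodule.smul_mem _ (tau x.2) hZ)
  refine (Submodule.smul_mem_iff_of_isUnit (lieAlg ℓ Γ) hu).1 ?_
  convert hmem using 1
  refine Prod.ext ?_ (by simp [scale_apply, tau₂])
  change u • (ℓ : ℤ_[ℓ]) ^ (e + m) • Y = tau x.1 • Z.1 - tau x.2 • Z.1
  rw [← sub_smul, he, show Z.1 = _ from hZY, smul_smul, smul_smul]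
  congr 1
  ring

theorem map_inr_scaledSl_le_lieAlg (hℓ : 2 < ℓ)
    (hm : scaledSl ℓ m ≤ (lieAlg ℓ Γ).map (LinearMap.snd ℤ_[ℓ] (Mat ℓ) (Mat ℓ)))
    (hx : x ∈ Γ) (hu : IsUnit u) (he : tau x.1 - tau x.2 = (ℓ : ℤ_[ℓ]) ^ e * u) :
    (scaledSl ℓ (e + m)).map (LinearMap.inr ℤ_[ℓ] (Mat ℓ) (Mat ℓ)) ≤ lieAlg ℓ Γ := by
  rintro _ ⟨_, ⟨Y, hY, rfl⟩, rfl⟩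
  obtain ⟨Z, hZ, hZY⟩ := hm (pow_smul_mem_scaledSl hY)
  have hmem := sub_mem (Submodule.smul_mem _ (tau x.1) hZ) (scale_tau₂_mem_lieAlg hℓ hx hZ)
  refine (Submodule.smul_mem_iff_of_isUnit (lieAlg ℓ Γ) hu).1 ?_
  convert hmem using 1
  refine Prod.ext (by simp [scale_apply, tau₂]) ?_
  change u • (ℓ : ℤ_[ℓ]) ^ (e + m) • Y = tau x.1 • Z.2 - tau x.2 • Z.2
  rw [← sub_smul, he, show Z.2 = _ from hZY, smul_smul, smul_smul]
  congr 1
  ring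

theorem ball₂_le_of_tau_sub (hℓ : 2 < ℓ) (hΓ : Γ ≤ ball₂ ℓ 1 1)
    (hopen : IsOpen (Γ : Set (SLpair ℓ))) (hpos : 0 < m)
    (hm₁ : scaledSl ℓ m ≤ (lieAlg ℓ Γ).map (LinearMap.fst ℤ_[ℓ] (Mat ℓ) (Mat ℓ)))
    (hm₂ : scaledSl ℓ m ≤ (lieAlg ℓ Γ).map (LinearMap.snd ℤ_[ℓ] (Mat ℓ) (Mat ℓ)))
    (hx : x ∈ Γ) (hu : IsUnit u) (he : tau x.1 - tau x.2 = (ℓ : ℤ_[ℓ]) ^ e * u) :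
    ball₂ ℓ (m + (e + m)) (m + (e + m)) ≤ Γ := by
  have hle : scaledSl₂ ℓ (m + (e + m)) ≤ lieSeries (lieAlg ℓ Γ) 1 := (Submodule.prod_le_iff ..).2
    ⟨map_inl_scaledSl_le_lieSeries_succ hℓ (j := 0) hm₁
        (map_inl_scaledSl_le_lieAlg hℓ hm₁ hx hu he),
      map_inr_scaledSl_le_lieSeries_succ hℓ (j := 0) hm₂
        (map_inr_scaledSl_le_lieAlg hℓ hm₂ hx hu he)⟩
  exact fun h hh => mem_of_theta₂_mem hℓ hΓ hopen (ball₂_anti (by omega) hh)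
    (hle ⟨theta₁_mem_scaledSl hℓ hh.1, theta₁_mem_scaledSl hℓ hh.2⟩)

theorem exists_pow_dvd_forall {S : Set ℤ_[ℓ]} (hS : ∃ x ∈ S, x ≠ 0) :
    ∃ e : ℕ, (∃ x ∈ S, ∃ u, IsUnit u ∧ x = (ℓ : ℤ_[ℓ]) ^ e * u) ∧ ∀ x ∈ S, (ℓ : ℤ_[ℓ]) ^ e ∣ x := by
  classical
  have hunit {x : ℤ_[ℓ]} (hx : x ≠ 0) : ∃ u, IsUnit u ∧ x = (ℓ : ℤ_[ℓ]) ^ x.valuation * u :=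
    ⟨_, Units.isUnit _, (PadicInt.unitCoeff_spec hx).trans (mul_comm _ _)⟩
  obtain ⟨x₀, hx₀, h₀⟩ := hS
  have hex : ∃ e : ℕ, ∃ x ∈ S, ∃ u, IsUnit u ∧ x = (ℓ : ℤ_[ℓ]) ^ e * u :=
    ⟨_, x₀, hx₀, hunit h₀⟩
  refine ⟨Nat.find hex, Nat.find_spec hex, fun x hx => ?_⟩
  by_cases h : x = 0
  · exact h ▸ dvd_zero _
  · obtain ⟨u, -, hu⟩ := hunit h
    rw [hu]
    exact (pow_dvd_pow _ (Nat.find_min' hex ⟨x, hx, hunit h⟩)).mul_right u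

theorem exists_tau_ne_one (hℓ : 2 < ℓ) (s : ℕ) : ∃ x ∈ ball ℓ s, tau x ≠ 1 := by
  obtain ⟨x, hx, hθ⟩ := exists_theta₁_eq hℓ s.succ_pos
    (pow_smul_mem_scaledSl (X := !![1, 0; 0, -1]) (by simp))
  refine ⟨x, ball_anti s.le_succ hx, fun htau => ?_⟩
  have hsq := theta₁_mul_self hℓ x
  rw [htau, hθ, one_pow, sub_self, zero_smul] at hsq
  exact (Fact.out : ℓ.Prime).ne_zero (by simpa using congrFun₂ hsq 0 0)

theorem tau_one (hℓ : 2 < ℓ) : tau (1 : SL(2, ℤ_[ℓ])) = 1 :=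
  (tau_eq_and_theta₁_eq hℓ (Matrix.trace_zero _ _) (by simp)).1

theorem exists_trace_precision (hℓ : 2 < ℓ) (hopen : IsOpen (Γ : Set (SLpair ℓ))) :
    ∃ e : ℕ, (∃ x ∈ Γ, ∃ u, IsUnit u ∧ tau x.1 - tau x.2 = (ℓ : ℤ_[ℓ]) ^ e * u) ∧
      ∀ x ∈ Γ, (ℓ : ℤ_[ℓ]) ^ e ∣ tau x.1 - tau x.2 := by
  obtain ⟨s, hs⟩ := exists_ball₂_le hopen
  obtain ⟨x, hx, htau⟩ := exists_tau_ne_one hℓ s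
  have hxΓ : (x, 1) ∈ Γ := hs (mem_ball₂.2 ⟨hx, one_mem _⟩)
  simpa only [Set.exists_mem_image, Set.forall_mem_image, SetLike.mem_coe] using
    exists_pow_dvd_forall (S := (fun x : SLpair ℓ => tau x.1 - tau x.2) '' Γ)
      ⟨_, ⟨_, hxΓ, rfl⟩, sub_ne_zero.2 (by rwa [tau_one hℓ])⟩

end Precision

section Commutators

section Unipotent

variable {K : Type*} [CommRing K]

theorem commutator_eq_one_add_smul {D U g : SL(2, K)} {Q V : Matrix (Fin 2) (Fin 2) K}
    {c d d' : K} (hQV : Q * V = V) (hVQ : V * Q = 0) (hV : V * V = 0) (hdd' : d * d' = 1)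
    (hD : (D : Matrix (Fin 2) (Fin 2) K) = d' • 1 + (d - d') • Q)
    (hU : (U : Matrix (Fin 2) (Fin 2) K) = 1 + c • V)
    (hg : (g : Matrix (Fin 2) (Fin 2) K) = 1 + ((d ^ 2 - 1) * c) • V) : ⁅D, U⁆ = g := by
  have hDV : (D : Matrix (Fin 2) (Fin 2) K) * V = d • V := by
    rw [hD, add_mul, smul_mul_assoc, smul_mul_assoc, one_mul, hQV, ← add_smul, add_sub_cancel]
  have hVD : V * (D : Matrix (Fin 2) (Fin 2) K) = d' • V := by
    rw [hD, mul_add, mul_smul_comm, mul_smul_comm, mul_one, hVQ, smul_zero, add_zero]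
  have hgU : (g : Matrix (Fin 2) (Fin 2) K) * U = 1 + (d ^ 2 * c) • V := by
    rw [hg, hU, add_mul, mul_add, mul_add, smul_mul_smul_comm, hV]
    simp only [one_mul, mul_one, smul_zero, add_zero]
    module
  suffices h : D * U = g * U * D by
    rw [commutatorElement_def, h, mul_inv_cancel_right, mul_inv_cancel_right]
  apply Subtype.ext
  simp only [Matrix.SpecialLinearGroup.coe_mul]
  rw [hgU, hU, mul_add, add_mul, mul_smul_comm, smul_mul_assoc, hDV, hVD, smul_smul, smul_smul,
    one_mul, mul_one]
  congr 2
  linear_combination -c * d * hdd'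

theorem coe_eq_mul_unipotents (g : SL(2, K)) {q : K} (hq : g 0 0 * q = 1) :
    (g : Matrix (Fin 2) (Fin 2) K) = (1 + ((g 1 0 - (g 0 0 - 1)) * q) • !![0, 0; 1, 0]) *
      (1 + (g 0 0 - 1) • !![1, -1; 1, -1]) *
      (1 + ((g 0 1 + (g 0 0 - 1)) * q) • !![0, 1; 0, 0]) := by
  have hdet := g.det_coe
  rw [Matrix.det_fin_two] at hdet
  refine (Matrix.eta_fin_two (g : Matrix (Fin 2) (Fin 2) K)).trans ?_
  simp only [Matrix.one_fin_two, Matrix.smul_of, Matrix.smul_cons, Matrix.smul_empty, smul_eq_mul,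
    Matrix.of_add_of, Matrix.add_cons, Matrix.head_cons, Matrix.tail_cons, Matrix.empty_add_empty,
    Matrix.mul_fin_two, EmbeddingLike.apply_eq_iff_eq, Matrix.vecCons_inj, and_true]
  refine ⟨⟨?_, ?_⟩, ?_, ?_⟩
  · ring
  · linear_combination -(g 0 1 + g 0 0 - 1) * hq
  · linear_combination -(g 1 0 - g 0 0 + 1) * hq
  · refine (IsUnit.of_mul_eq_one q hq).mul_left_cancel ?_
    linear_combination hdet - ((g 1 0 - (g 0 0 - 1)) * (g 0 1 + (g 0 0 - 1)) * (g 0 0 * q + 1) +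
      (g 1 0 - (g 0 0 - 1)) * (1 - g 0 0) + (g 0 0 - 1) * (g 0 1 + (g 0 0 - 1))) * hq

end Unipotent

variable {P : Type*} [Group P] {H : Subgroup P} {ι : SL(2, ℤ_[ℓ]) →* P} {p : P →* SL(2, ℤ_[ℓ])}
  {a m : ℕ}

theorem exists_diagonal_entries (hℓ : 2 < ℓ) (ha : 0 < a) {w : ℤ_[ℓ]} (hw : (ℓ : ℤ_[ℓ]) ^ a ∣ w) :
    ∃ d d' : ℤ_[ℓ], d * d' = 1 ∧ d ^ 2 - 1 = w ∧
      (ℓ : ℤ_[ℓ]) ^ a ∣ d - 1 ∧ (ℓ : ℤ_[ℓ]) ^ a ∣ d' - 1 := by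
  obtain ⟨d, hd, hd1⟩ := exists_sq_eq hℓ ha (u := 1 + w) (by simpa using hw)
  obtain ⟨d', hd'⟩ := (isUnit_of_dvd_sub isUnit_one
    ((dvd_pow_self _ ha.ne').trans hd1)).exists_right_inv
  refine ⟨d, d', hd', by rw [hd, add_sub_cancel_left], hd1, ?_⟩
  rw [show d' - 1 = -(d - 1) * d' by linear_combination hd']
  exact hd1.neg_right.mul_right _

theorem exists_mem_comap_commutator_eq (hℓ : 2 < ℓ) (hι : ∀ h t, ⁅ι h, t⁆ = ι ⁅h, p t⁆)
    (ha : 0 < a) (haH : ball ℓ a ≤ H.comap ι) (hH : LiftsUnipotents H p ((ℓ : ℤ_[ℓ]) ^ m))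
    {Q V : Mat ℓ} (htr : Q.trace = 1) (hdet : Q.det = 0) (hQV : Q * V = V) (hVQ : V * Q = 0)
    {b : ℤ_[ℓ]} (hb : (ℓ : ℤ_[ℓ]) ^ (a + m) ∣ b) :
    ∃ g ∈ ⁅H, H⁆.comap ι, (g : Mat ℓ) = 1 + b • V := by
  obtain ⟨b, rfl⟩ := hb
  have hVtr : V.trace = 0 := by rw [← hQV, Matrix.trace_mul_comm, hVQ, Matrix.trace_zero]
  have hVdet : V.det = 0 := by rw [← hQV, Matrix.det_mul, hdet, zero_mul]
  obtain ⟨t, ht, htV⟩ := hH V hVtr hVdet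
  obtain ⟨d, d', hdd', hd, hd₁, hd₁'⟩ := exists_diagonal_entries hℓ ha (dvd_mul_right _ b)
  have hDdet : (d' • 1 + (d - d') • Q : Mat ℓ).det = 1 := by
    rw [det_smul_one_add, Matrix.trace_smul, Matrix.det_smul, htr, hdet, smul_eq_mul]
    linear_combination hdd'
  obtain ⟨D, hD⟩ : ∃ D : SL(2, ℤ_[ℓ]), (D : Mat ℓ) = d' • 1 + (d - d') • Q := ⟨⟨_, hDdet⟩, rfl⟩
  obtain ⟨g, hg⟩ : ∃ g : SL(2, ℤ_[ℓ]), (g : Mat ℓ) = 1 + ((ℓ : ℤ_[ℓ]) ^ (a + m) * b) • V :=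
    ⟨⟨_, det_one_add_smul hVtr hVdet _⟩, rfl⟩
  have hDball : D ∈ ball ℓ a := by
    rw [mem_ball_iff, hD, show d' • 1 + (d - d') • Q - 1 = (d' - 1) • 1 + ((d - 1) - (d' - 1)) • Q
      by module]
    exact add_mem (smul_mem_smul_top_of_dvd hd₁' _) (smul_mem_smul_top_of_dvd (dvd_sub hd₁ hd₁') _)
  refine ⟨g, ?_, hg⟩
  have hcomm : ⁅D, p t⁆ = g := commutator_eq_one_add_smul hQV hVQ
    (mul_self_eq_zero_of_trace_det_eq_zero hVtr hVdet)
    hdd' hD htV (by rw [hg, hd, pow_add, mul_right_comm])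
  rw [Subgroup.mem_comap, ← hcomm, ← hι]
  exact Subgroup.commutator_mem_commutator (haH hDball) ht

theorem ball_le_comap_commutator (hℓ : 2 < ℓ) (hι : ∀ h t, ⁅ι h, t⁆ = ι ⁅h, p t⁆)
    (ha : 0 < a) (haH : ball ℓ a ≤ H.comap ι) (hH : LiftsUnipotents H p ((ℓ : ℤ_[ℓ]) ^ m)) :
    ball ℓ (a + m) ≤ ⁅H, H⁆.comap ι := by
  intro g hg
  obtain ⟨h₀₀, h₀₁, h₁₀, -⟩ := mem_ball_iff_entries.1 hg
  obtain ⟨q, hq⟩ := (isUnit_of_dvd_sub isUnit_one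
    ((dvd_pow_self _ (Nat.add_pos_left ha m).ne').trans h₀₀)).exists_right_inv
  have hunipotent {Q V : Mat ℓ} := exists_mem_comap_commutator_eq hℓ hι ha haH hH (Q := Q) (V := V)
  obtain ⟨A, hA, hAV⟩ := hunipotent (Q := !![0, 0; 0, 1]) (V := !![0, 0; 1, 0]) (by simp)
    (by simp [Matrix.det_fin_two]) (by ext i j; fin_cases i <;> fin_cases j <;> simp)
    (by ext i j; fin_cases i <;> fin_cases j <;> simp) ((dvd_sub h₁₀ h₀₀).mul_right q)
  obtain ⟨B, hB, hBV⟩ := hunipotent (Q := !![1, 0; 1, 0]) (V := !![1, -1; 1, -1]) (by simp)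
    (by simp [Matrix.det_fin_two]) (by simp)
    (by simp [← Matrix.ext_iff, Fin.forall_fin_two]) h₀₀
  obtain ⟨C, hC, hCV⟩ := hunipotent (Q := !![1, 0; 0, 0]) (V := !![0, 1; 0, 0]) (by simp)
    (by simp [Matrix.det_fin_two]) (by ext i j; fin_cases i <;> fin_cases j <;> simp)
    (by ext i j; fin_cases i <;> fin_cases j <;> simp) ((dvd_add h₀₁ h₀₀).mul_right q)
  have hprod : g = A * B * C := Subtype.ext <| by
    rw [coe_eq_mul_unipotents g hq, ← hAV, ← hBV, ← hCV]
    rfl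
  exact hprod ▸ mul_mem (mul_mem hA hB) hC

theorem ball₂_le_commutator (hℓ : 2 < ℓ) {H : Subgroup (SLpair ℓ)} (ha : 0 < a)
    (haH : ball₂ ℓ a a ≤ H) (h₁ : LiftsUnipotents H (MonoidHom.fst _ _) ((ℓ : ℤ_[ℓ]) ^ m))
    (h₂ : LiftsUnipotents H (MonoidHom.snd _ _) ((ℓ : ℤ_[ℓ]) ^ m)) :
    ball₂ ℓ (a + m) (a + m) ≤ ⁅H, H⁆ := by
  rintro ⟨g₁, g₂⟩ hg
  have hle₁ : ball ℓ (a + m) ≤ ⁅H, H⁆.comap (MonoidHom.inl _ _) := ball_le_comap_commutator hℓ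
    (fun h t => by simp [commutatorElement_def, Prod.ext_iff]) ha
    (fun x hx => haH (mem_ball₂.2 ⟨hx, one_mem _⟩)) h₁
  have hle₂ : ball ℓ (a + m) ≤ ⁅H, H⁆.comap (MonoidHom.inr _ _) := ball_le_comap_commutator hℓ
    (fun h t => by simp [commutatorElement_def, Prod.ext_iff]) ha
    (fun x hx => haH (mem_ball₂.2 ⟨one_mem _, hx⟩)) h₂
  simpa using mul_mem (Subgroup.mem_comap.1 (hle₁ hg.1)) (Subgroup.mem_comap.1 (hle₂ hg.2))

end Commutators

section Signs

/-- The difference of the traces of the two components. It vanishes on the diagonal of `M₂(ℤ_ℓ)²`,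
and its `ℓ`-divisibility measures how close a subalgebra is to a conjugate of the diagonal. -/
noncomputable def traceDiff (ℓ : ℕ) [Fact ℓ.Prime] : MatPair ℓ →ₗ[ℤ_[ℓ]] ℤ_[ℓ] :=
  Matrix.traceLinearMap (Fin 2) ℤ_[ℓ] ℤ_[ℓ] ∘ₗ LinearMap.fst _ _ _ -
    Matrix.traceLinearMap (Fin 2) ℤ_[ℓ] ℤ_[ℓ] ∘ₗ LinearMap.snd _ _ _

theorem traceDiff_apply (X : MatPair ℓ) : traceDiff ℓ X = X.1.trace - X.2.trace := rfl

/-- The subalgebra `A` of `M₂(ℤ_ℓ)²` looks like the diagonal modulo `ℓ ^ e`: the two components of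
its elements have traces congruent modulo `ℓ ^ e`, while both its projections contain
`ℓ ^ m M₂(ℤ_ℓ)`. -/
structure NearlyDiagonal (A : Subalgebra ℤ_[ℓ] (MatPair ℓ)) (e m : ℕ) : Prop where
  pow_dvd_traceDiff : ∀ r ∈ A, (ℓ : ℤ_[ℓ]) ^ e ∣ traceDiff ℓ r
  exists_fst_eq : ∀ Y : Mat ℓ, ∃ r ∈ A, r.1 = (ℓ : ℤ_[ℓ]) ^ m • Y
  exists_snd_eq : ∀ Y : Mat ℓ, ∃ r ∈ A, r.2 = (ℓ : ℤ_[ℓ]) ^ m • Y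

/-- The element `t` has sign `χ` with respect to `A`: modulo `ℓ ^ f`, the algebra `A` contains
`ℓ ^ m • (t₁, χ t₂)`. -/
def HasSign (A : Subalgebra ℤ_[ℓ] (MatPair ℓ)) (m f : ℕ) (t : SLpair ℓ) (χ : ℤˣ) : Prop :=
  ∃ r ∈ A, r.1 = (ℓ : ℤ_[ℓ]) ^ m • (t.1 : Mat ℓ) ∧
    r.2 - (((χ : ℤ) : ℤ_[ℓ]) * (ℓ : ℤ_[ℓ]) ^ m) • (t.2 : Mat ℓ) ∈
      (ℓ : ℤ_[ℓ]) ^ f • (⊤ : Submodule ℤ_[ℓ] (Mat ℓ))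

theorem exists_sign_of_dvd_sq_sub_one (hℓ : 2 < ℓ) {c y : ℤ_[ℓ]} (h : c ∣ y ^ 2 - 1) :
    ∃ χ : ℤˣ, c ∣ y - (χ : ℤ) := by
  have hfactor : y ^ 2 - 1 = (1 + y) * -(1 - y) := by ring
  rw [hfactor] at h
  have hsum : IsUnit ((1 + y) + (1 - y)) := by
    rw [add_add_sub_cancel, one_add_one_eq_two]
    exact isUnit_two hℓ
  rcases IsLocalRing.isUnit_or_isUnit_of_isUnit_add hsum with hu | hu
  · exact ⟨1, by simpa using hu.dvd_mul_left.1 h⟩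
  · exact ⟨-1, by simpa [add_comm] using hu.neg.dvd_mul_right.1 h⟩

theorem exists_sign_of_dvd_sq_sub_sq (hℓ : 2 < ℓ) {m f g : ℕ} (hf : 2 * m + f ≤ g) {x : ℤ_[ℓ]}
    (hx : (ℓ : ℤ_[ℓ]) ^ g ∣ x ^ 2 - ((ℓ : ℤ_[ℓ]) ^ m) ^ 2) :
    ∃ χ : ℤˣ, (ℓ : ℤ_[ℓ]) ^ (m + f) ∣ x - (χ : ℤ) * (ℓ : ℤ_[ℓ]) ^ m := by
  have hle : 2 * m ≤ g := by omega
  have hsq : ((ℓ : ℤ_[ℓ]) ^ m) ^ 2 ∣ x ^ 2 := by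
    rw [← dvd_sub_self_right, ← pow_mul']
    exact (pow_dvd_pow _ hle).trans (by rwa [← pow_mul'] at hx)
  obtain ⟨y, rfl⟩ := (IsIntegrallyClosed.pow_dvd_pow_iff two_ne_zero).1 hsq
  have hy : (ℓ : ℤ_[ℓ]) ^ f ∣ y ^ 2 - 1 := by
    refine pow_dvd_of_pow_dvd_mul hf (hx.trans (dvd_of_eq ?_))
    ring
  obtain ⟨χ, hχ⟩ := exists_sign_of_dvd_sq_sub_one hℓ hy
  refine ⟨χ, ?_⟩
  rw [pow_add, mul_comm _ ((ℓ : ℤ_[ℓ]) ^ m), ← mul_sub]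
  exact mul_dvd_mul_left _ hχ

theorem sign_eq_of_dvd_sub (hℓ : 2 < ℓ) {χ χ' : ℤˣ}
    (h : (ℓ : ℤ_[ℓ]) ∣ ((χ : ℤ) : ℤ_[ℓ]) - ((χ' : ℤ) : ℤ_[ℓ])) : χ = χ' := by
  have h2 := isUnit_iff_not_dvd.1 (isUnit_two hℓ)
  rcases Int.units_eq_one_or χ with rfl | rfl <;> rcases Int.units_eq_one_or χ' with rfl | rfl
  · rfl
  · exact absurd (by simpa [one_add_one_eq_two] using h) h2
  · exact absurd (by simpa [← neg_add', one_add_one_eq_two] using h) h2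
  · rfl

theorem two_mul_det {K : Type*} [CommRing K] (X : Matrix (Fin 2) (Fin 2) K) :
    2 * X.det = X.trace ^ 2 - (X * X).trace := by
  simp only [Matrix.det_fin_two, Matrix.trace_fin_two, Matrix.mul_apply, Fin.sum_univ_two]
  ring

theorem sub_smul_one_mem_of_commutator_mem {K : Type*} [CommRing K] {c : K}
    {w : Matrix (Fin 2) (Fin 2) K}
    (h : ∀ Y, w * Y - Y * w ∈ c • (⊤ : Submodule K (Matrix (Fin 2) (Fin 2) K))) :
    w - w 0 0 • 1 ∈ c • (⊤ : Submodule K (Matrix (Fin 2) (Fin 2) K)) := by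
  have hentry (Y) (i j) := matrix_mem_smul_top_iff.1 (h Y) i j
  simp only [Matrix.sub_apply, Matrix.mul_apply, Fin.sum_univ_two] at hentry
  have h₁₀ : c ∣ w 1 0 := by simpa using hentry !![0, 1; 0, 0] 1 1
  have h₁₁ : c ∣ w 0 0 - w 1 1 := by simpa using hentry !![0, 1; 0, 0] 0 1
  have h₀₁ : c ∣ w 0 1 := by simpa using hentry !![0, 0; 1, 0] 0 0
  simp [matrix_mem_smul_top_iff, Fin.forall_fin_two, h₁₀, h₀₁, dvd_sub_comm.1 h₁₁]

theorem dvd_det_sub_sq {K : Type*} [CommRing K] {c a : K} {w : Matrix (Fin 2) (Fin 2) K}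
    (h : w - a • 1 ∈ c • (⊤ : Submodule K (Matrix (Fin 2) (Fin 2) K))) : c ∣ w.det - a ^ 2 := by
  rw [← add_sub_cancel (a • 1) w, det_smul_one_add, add_assoc, add_sub_cancel_left]
  exact dvd_add ((dvd_trace_of_mem_smul_top h).mul_left a) (dvd_det_of_mem_smul_top h)

namespace NearlyDiagonal

variable {A : Subalgebra ℤ_[ℓ] (MatPair ℓ)} {e m f : ℕ}

theorem snd_mem_smul_top (hA : NearlyDiagonal A e m) (hf : m + f ≤ e) {q : MatPair ℓ}
    (hq : q ∈ A) (hq₁ : q.1 = 0) : q.2 ∈ (ℓ : ℤ_[ℓ]) ^ f • (⊤ : Submodule ℤ_[ℓ] (Mat ℓ)) := by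
  refine matrix_mem_smul_top_iff.2 fun i j => ?_
  obtain ⟨r, hr, hr₂⟩ := hA.exists_snd_eq (Matrix.single j i 1)
  have htrace : (q.2 * Matrix.single j i 1).trace = q.2 i j := by
    simp [Matrix.trace_mul_single]
  have h := hA.pow_dvd_traceDiff _ (mul_mem hq hr)
  rw [traceDiff_apply, Prod.fst_mul, Prod.snd_mul, hq₁, hr₂, zero_mul, Matrix.trace_zero,
    mul_smul_comm, Matrix.trace_smul, htrace, zero_sub, dvd_neg, smul_eq_mul] at h
  exact pow_dvd_of_pow_dvd_mul hf h

theorem pow_dvd_det_sub_det (hℓ : 2 < ℓ) (hA : NearlyDiagonal A e m) {r : MatPair ℓ}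
    (hr : r ∈ A) : (ℓ : ℤ_[ℓ]) ^ e ∣ r.1.det - r.2.det := by
  have h₁ := hA.pow_dvd_traceDiff r hr
  have h₂ := hA.pow_dvd_traceDiff _ (mul_mem hr hr)
  rw [traceDiff_apply] at h₁ h₂
  rw [← (isUnit_two hℓ).dvd_mul_left, mul_sub, two_mul_det, two_mul_det]
  convert dvd_sub (h₁.mul_right (r.1.trace + r.2.trace)) h₂ using 1
  rw [Prod.fst_mul, Prod.snd_mul]
  ring

theorem commutator_mem_smul_top (hA : NearlyDiagonal A e m) (hf : 2 * m + f ≤ e) {t : SLpair ℓ}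
    (ht : ∀ z ∈ A, coePair ℓ t * z * coePair ℓ t⁻¹ ∈ A) {r : MatPair ℓ} (hr : r ∈ A)
    (hr₁ : r.1 = (ℓ : ℤ_[ℓ]) ^ m • (t.1 : Mat ℓ)) {w : Mat ℓ} (hw : r.2 = (t.2 : Mat ℓ) * w)
    (Y : Mat ℓ) : w * Y - Y * w ∈ (ℓ : ℤ_[ℓ]) ^ f • (⊤ : Submodule ℤ_[ℓ] (Mat ℓ)) := by
  obtain ⟨z, hz, hz₂⟩ := hA.exists_snd_eq Y
  have inv_mul₁ : ((t⁻¹).1 : Mat ℓ) * t.1 = 1 := congrArg Subtype.val (inv_mul_cancel t.1)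
  have inv_mul₂ : ((t⁻¹).2 : Mat ℓ) * t.2 = 1 := congrArg Subtype.val (inv_mul_cancel t.2)
  have hq₁ : (r * z - coePair ℓ t * z * coePair ℓ t⁻¹ * r).1 = 0 := by
    change r.1 * z.1 - (t.1 : Mat ℓ) * z.1 * (t⁻¹).1 * r.1 = 0
    rw [hr₁, smul_mul_assoc, mul_smul_comm, mul_assoc _ _ (t.1 : Mat ℓ), inv_mul₁, mul_one,
      sub_self]
  have hq₂ : ((t⁻¹).2 : Mat ℓ) * (r * z - coePair ℓ t * z * coePair ℓ t⁻¹ * r).2 =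
      (ℓ : ℤ_[ℓ]) ^ m • (w * Y - Y * w) := by
    change ((t⁻¹).2 : Mat ℓ) * (r.2 * z.2 - (t.2 : Mat ℓ) * z.2 * (t⁻¹).2 * r.2) = _
    rw [hw, hz₂, mul_sub]
    simp only [← mul_assoc, inv_mul₂, one_mul, mul_smul_comm, smul_mul_assoc]
    rw [mul_assoc Y, inv_mul₂, mul_one, smul_sub]
  have hmem := map_mem_smul_top (LinearMap.mulLeft ℤ_[ℓ] ((t⁻¹).2 : Mat ℓ))
    (hA.snd_mem_smul_top (f := m + f) (by omega)
      (sub_mem (mul_mem hr hz) (mul_mem (ht z hz) hr)) hq₁)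
  rw [LinearMap.mulLeft_apply, hq₂, matrix_mem_smul_top_iff] at hmem
  exact matrix_mem_smul_top_iff.2 fun i j => pow_dvd_of_pow_dvd_mul le_rfl (hmem i j)

theorem exists_hasSign (hℓ : 2 < ℓ) (hA : NearlyDiagonal A e m) (hf : 4 * m + f ≤ e)
    {t : SLpair ℓ} (ht : ∀ z ∈ A, coePair ℓ t * z * coePair ℓ t⁻¹ ∈ A) :
    ∃ χ : ℤˣ, HasSign A m (m + f) t χ := by
  obtain ⟨r, hr, hr₁⟩ := hA.exists_fst_eq t.1
  obtain ⟨w, hw⟩ : ∃ w : Mat ℓ, r.2 = (t.2 : Mat ℓ) * w :=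
    ⟨(t.2⁻¹ : SL(2, ℤ_[ℓ])) * r.2, by
      rw [← mul_assoc, ← Matrix.SpecialLinearGroup.coe_mul, mul_inv_cancel,
        Matrix.SpecialLinearGroup.coe_one, one_mul]⟩
  have hscalar := sub_smul_one_mem_of_commutator_mem
    (hA.commutator_mem_smul_top (f := 2 * m + f) (by omega) ht hr hr₁ hw)
  have hdet : (ℓ : ℤ_[ℓ]) ^ (2 * m + f) ∣ ((ℓ : ℤ_[ℓ]) ^ m) ^ 2 - w.det := by
    have h := hA.pow_dvd_det_sub_det hℓ hr
    rw [hr₁, hw, Matrix.det_smul, Matrix.det_mul, t.1.det_coe, t.2.det_coe, one_mul, mul_one,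
      Fintype.card_fin] at h
    exact (pow_dvd_pow _ (by omega)).trans h
  have hsq : (ℓ : ℤ_[ℓ]) ^ (2 * m + f) ∣ w 0 0 ^ 2 - ((ℓ : ℤ_[ℓ]) ^ m) ^ 2 := by
    rw [← dvd_neg, neg_sub, ← sub_add_sub_cancel _ w.det]
    exact dvd_add hdet (dvd_det_sub_sq hscalar)
  obtain ⟨χ, hχ⟩ := exists_sign_of_dvd_sq_sub_sq hℓ le_rfl hsq
  have hw_mem : w - (((χ : ℤ) : ℤ_[ℓ]) * (ℓ : ℤ_[ℓ]) ^ m) • 1 ∈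
      (ℓ : ℤ_[ℓ]) ^ (m + f) • (⊤ : Submodule ℤ_[ℓ] (Mat ℓ)) := by
    rw [← sub_add_sub_cancel _ (w 0 0 • (1 : Mat ℓ)), ← sub_smul]
    exact add_mem (mem_smul_top_of_dvd (pow_dvd_pow _ (by omega)) hscalar)
      (smul_mem_smul_top_of_dvd hχ 1)
  refine ⟨χ, r, hr, hr₁, ?_⟩
  simpa [mul_sub, hw] using map_mem_smul_top (LinearMap.mulLeft ℤ_[ℓ] (t.2 : Mat ℓ)) hw_mem

end NearlyDiagonal

end Signs

section SignCharacter

variable {A : Subalgebra ℤ_[ℓ] (MatPair ℓ)} {e m f : ℕ}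

theorem hasSign_of_mem {t : SLpair ℓ} (ht : coePair ℓ t ∈ A) : HasSign A m f t 1 := by
  refine ⟨(ℓ : ℤ_[ℓ]) ^ m • coePair ℓ t, A.smul_mem ht _, rfl, ?_⟩
  have hzero : ((ℓ : ℤ_[ℓ]) ^ m • coePair ℓ t).2 -
      ((((1 : ℤˣ) : ℤ) : ℤ_[ℓ]) * (ℓ : ℤ_[ℓ]) ^ m) • (t.2 : Mat ℓ) = 0 := by
    rw [Units.val_one, Int.cast_one, one_mul]
    exact sub_self _
  exact hzero ▸ zero_mem _

theorem hasSign_one : HasSign A m f 1 1 :=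
  hasSign_of_mem (by simp)

namespace NearlyDiagonal

theorem sign_mul (hℓ : 2 < ℓ) (hA : NearlyDiagonal A e m) (hf : m + f ≤ e) (hm : 2 * m < f)
    {t t' : SLpair ℓ} {χ χ' χ'' : ℤˣ} (h : HasSign A m f t χ) (h' : HasSign A m f t' χ')
    (h'' : HasSign A m f (t * t') χ'') : χ'' = χ * χ' := by
  obtain ⟨r, hr, hr₁, hr₂⟩ := h
  obtain ⟨r', hr', hr'₁, hr'₂⟩ := h'
  obtain ⟨r'', hr'', hr''₁, hr''₂⟩ := h''
  have hq := hA.snd_mem_smul_top hf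
    (sub_mem (A.smul_mem hr'' ((ℓ : ℤ_[ℓ]) ^ m)) (mul_mem hr hr')) (by
      change (ℓ : ℤ_[ℓ]) ^ m • r''.1 - r.1 * r'.1 = 0
      rw [hr₁, hr'₁, hr''₁, smul_mul_smul_comm, smul_smul]
      exact sub_self _)
  set ε : ℤ_[ℓ] := ((χ : ℤ) : ℤ_[ℓ])
  set ε' : ℤ_[ℓ] := ((χ' : ℤ) : ℤ_[ℓ])
  set ε'' : ℤ_[ℓ] := ((χ'' : ℤ) : ℤ_[ℓ])
  have hscalar : ((ℓ : ℤ_[ℓ]) ^ (2 * m) * (ε'' - ε * ε')) • ((t * t').2 : Mat ℓ) ∈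
      (ℓ : ℤ_[ℓ]) ^ f • (⊤ : Submodule ℤ_[ℓ] (Mat ℓ)) := by
    have h₁ := Submodule.smul_mem _ ((ℓ : ℤ_[ℓ]) ^ m) hr''₂
    have h₂ := map_mem_smul_top (LinearMap.mulRight ℤ_[ℓ] r'.2) hr₂
    have h₃ := map_mem_smul_top (LinearMap.mulLeft ℤ_[ℓ] ((ε * (ℓ : ℤ_[ℓ]) ^ m) • (t.2 : Mat ℓ)))
      hr'₂
    convert add_mem (sub_mem hq h₁) (add_mem h₂ h₃) using 1
    simp only [LinearMap.mulRight_apply, LinearMap.mulLeft_apply, Prod.snd_sub,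
      Prod.smul_snd, Prod.snd_mul, mul_sub, sub_mul, smul_mul_assoc, mul_smul_comm]
    module
  have hdvd : (ℓ : ℤ_[ℓ]) ^ f ∣ (ℓ : ℤ_[ℓ]) ^ (2 * m) * (ε'' - ε * ε') := by
    have h := map_mem_smul_top
      (LinearMap.mulRight ℤ_[ℓ] (((t * t').2⁻¹ : SL(2, ℤ_[ℓ])) : Mat ℓ)) hscalar
    rw [LinearMap.mulRight_apply, smul_mul_assoc, ← Matrix.SpecialLinearGroup.coe_mul,
      mul_inv_cancel, Matrix.SpecialLinearGroup.coe_one] at h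
    simpa using matrix_mem_smul_top_iff.1 h 0 0
  refine sign_eq_of_dvd_sub hℓ ?_
  simpa [ε, ε', ε''] using pow_dvd_of_pow_dvd_mul (c := 1) hm hdvd

theorem exists_sign_subgroup (hℓ : 2 < ℓ) (hA : NearlyDiagonal A e m) (hf : 4 * m + f ≤ e)
    (hm : m < f) {G : Subgroup (SLpair ℓ)}
    (hG : ∀ t ∈ G, ∀ z ∈ A, coePair ℓ t * z * coePair ℓ t⁻¹ ∈ A) :
    ∃ T : Subgroup (SLpair ℓ), T.relIndex G ∣ 2 ∧
      ∀ t, t ∈ T ↔ t ∈ G ∧ HasSign A m (m + f) t 1 := by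
  have mul_eq {t t' : SLpair ℓ} {χ χ' χ'' : ℤˣ} (h : HasSign A m (m + f) t χ) :=
    hA.sign_mul hℓ (by omega) (by omega) (t' := t') (χ' := χ') (χ'' := χ'') h
  choose χ hχ using fun t : G => hA.exists_hasSign hℓ hf (hG t t.2)
  let sign : G →* ℤˣ := MonoidHom.mk' χ fun t t' => mul_eq (hχ t) (hχ t') (hχ (t * t'))
  have sign_eq_one_iff (t : G) : sign t = 1 ↔ HasSign A m (m + f) t 1 := by
    refine ⟨fun h => h ▸ hχ t, fun h => ?_⟩
    have hsign := mul_eq (t' := 1) h hasSign_one (by rw [mul_one]; exact hχ t)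
    rwa [mul_one] at hsign
  refine ⟨sign.ker.map G.subtype, ?_, fun t => ?_⟩
  · rw [Subgroup.relIndex, Subgroup.subgroupOf,
      Subgroup.comap_map_eq_self_of_injective G.subtype_injective, Subgroup.index_ker]
    simpa using sign.range.card_subgroup_dvd_card
  · simp [sign_eq_one_iff, and_comm]

theorem pow_dvd_pow_mul_traceDiff (hA : NearlyDiagonal A e m) (hf : f ≤ e) {t : SLpair ℓ}
    (ht : HasSign A m f t 1) {z : MatPair ℓ} (hz : z ∈ A) :
    (ℓ : ℤ_[ℓ]) ^ f ∣ (ℓ : ℤ_[ℓ]) ^ m * traceDiff ℓ (coePair ℓ t * z) := by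
  obtain ⟨r, hr, hr₁, hr₂⟩ := ht
  have h₁ := (pow_dvd_pow _ hf).trans (hA.pow_dvd_traceDiff _ (mul_mem hr hz))
  have h₂ := dvd_trace_of_mem_smul_top (map_mem_smul_top (LinearMap.mulRight ℤ_[ℓ] z.2) hr₂)
  convert dvd_add h₁ h₂ using 1
  have hmul : coePair ℓ t * z = ((t.1 : Mat ℓ) * z.1, (t.2 : Mat ℓ) * z.2) := rfl
  simp only [hmul, traceDiff_apply, Prod.fst_mul, Prod.snd_mul, hr₁, LinearMap.mulRight_apply,
    sub_mul, Matrix.trace_sub, smul_mul_assoc, Matrix.trace_smul, smul_eq_mul, Units.val_one,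
    Int.cast_one]
  ring

theorem pow_dvd_pow_mul_traceDiff_of_mem_lieAlg (hA : NearlyDiagonal A e m) (hf : f ≤ e)
    {T : Subgroup (SLpair ℓ)} (hT : ∀ t ∈ T, HasSign A m f t 1) {z : MatPair ℓ} (hz : z ∈ A)
    {X : MatPair ℓ} (hX : X ∈ lieAlg ℓ T) :
    (ℓ : ℤ_[ℓ]) ^ f ∣ (ℓ : ℤ_[ℓ]) ^ m * traceDiff ℓ (X * z) := by
  let φ : MatPair ℓ →ₗ[ℤ_[ℓ]] ℤ_[ℓ] :=
    (ℓ : ℤ_[ℓ]) ^ m • traceDiff ℓ ∘ₗ LinearMap.mulRight ℤ_[ℓ] z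
  suffices h : lieAlg ℓ T ≤ Submodule.comap φ (Ideal.span {(ℓ : ℤ_[ℓ]) ^ f}) from
    Ideal.mem_span_singleton.1 (h hX)
  refine Submodule.span_le.2 ?_
  rintro _ ⟨t, ht, rfl⟩
  refine Ideal.mem_span_singleton.2 ?_
  have h₁ := hA.pow_dvd_pow_mul_traceDiff hf (hT t ht) hz
  have h₂ := hA.pow_dvd_pow_mul_traceDiff hf (hT t ht) (one_mem A)
  have h₃ := (pow_dvd_pow _ hf).trans (hA.pow_dvd_traceDiff z hz)
  convert dvd_sub h₁ (dvd_add (h₂.mul_left (Ring.inverse 2 * z.1.trace))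
    (h₃.mul_left ((ℓ : ℤ_[ℓ]) ^ m * (Ring.inverse 2 * (t.2 : Mat ℓ).trace)))) using 1
  have hcoe : coePair ℓ t = ((t.1 : Mat ℓ), (t.2 : Mat ℓ)) := rfl
  simp only [φ, LinearMap.smul_apply, LinearMap.comp_apply, LinearMap.mulRight_apply, hcoe, theta₂,
    theta₁, traceDiff_apply, Prod.fst_mul, Prod.snd_mul, mul_one, sub_mul, Matrix.trace_sub,
    smul_mul_assoc, one_mul, Matrix.trace_smul, smul_eq_mul]
  ring

theorem le_of_scaledSl_le (hA : NearlyDiagonal A e m) (hf : f ≤ e) {T : Subgroup (SLpair ℓ)}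
    (hT : ∀ t ∈ T, HasSign A m f t 1) {k : ℕ}
    (hk : (scaledSl ℓ k).prod (scaledSl ℓ k) ≤ lieAlg ℓ T) : f ≤ k + 2 * m := by
  obtain ⟨z, hz, hz₁⟩ := hA.exists_fst_eq !![0, 0; 1, 0]
  have hX : ((ℓ : ℤ_[ℓ]) ^ k • !![0, 1; 0, 0], 0) ∈ lieAlg ℓ T :=
    hk (Submodule.mem_prod.2 ⟨pow_smul_mem_scaledSl (by simp), zero_mem _⟩)
  have h := hA.pow_dvd_pow_mul_traceDiff_of_mem_lieAlg hf hT hz hX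
  have htrace : (ℓ : ℤ_[ℓ]) ^ m *
      traceDiff ℓ (((ℓ : ℤ_[ℓ]) ^ k • !![0, 1; 0, 0], 0) * z) = (ℓ : ℤ_[ℓ]) ^ (k + 2 * m) := by
    rw [traceDiff_apply, Prod.fst_mul, Prod.snd_mul, hz₁, smul_mul_smul_comm, Matrix.mul_fin_two,
      Matrix.trace_smul, Matrix.trace_fin_two_of]
    simp only [zero_mul, Matrix.trace_zero, smul_eq_mul]
    ring
  exact pow_dvd_pow_iff_le.1 (htrace ▸ h)

end NearlyDiagonal

end SignCharacter

section SpanOfSubgroup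

variable {Γ : Subgroup (SLpair ℓ)}

theorem nearlyDiagonal_spanAlg (hℓ : 2 < ℓ) {e m : ℕ}
    (h₁ : LiftsUnipotents Γ (MonoidHom.fst _ _) ((ℓ : ℤ_[ℓ]) ^ m))
    (h₂ : LiftsUnipotents Γ (MonoidHom.snd _ _) ((ℓ : ℤ_[ℓ]) ^ m))
    (he : ∀ x ∈ Γ, (ℓ : ℤ_[ℓ]) ^ e ∣ tau x.1 - tau x.2) : NearlyDiagonal (spanAlg Γ) e m where
  pow_dvd_traceDiff r hr := by
    have hle : Subalgebra.toSubmodule (spanAlg Γ) ≤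
        Submodule.comap (traceDiff ℓ) (Ideal.span {(ℓ : ℤ_[ℓ]) ^ e}) := spanAlg_le fun x hx => by
      change (x.1 : Mat ℓ).trace - (x.2 : Mat ℓ).trace ∈ Ideal.span {(ℓ : ℤ_[ℓ]) ^ e}
      rw [trace_eq_two_mul_tau hℓ, trace_eq_two_mul_tau hℓ, ← mul_sub]
      exact Ideal.mem_span_singleton.2 ((he x hx).mul_left 2)
    exact Ideal.mem_span_singleton.1 (hle hr)
  exists_fst_eq := exists_mem_spanAlg_eq hℓ (q := LinearMap.fst _ _ _) (fun _ => rfl) h₁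
  exists_snd_eq := exists_mem_spanAlg_eq hℓ (q := LinearMap.snd _ _ _) (fun _ => rfl) h₂

theorem conj_mem_spanAlg {t : SLpair ℓ} (ht : ∀ x ∈ Γ, t * x * t⁻¹ ∈ Γ) {z : MatPair ℓ}
    (hz : z ∈ spanAlg Γ) : coePair ℓ t * z * coePair ℓ t⁻¹ ∈ spanAlg Γ := by
  have hle : Subalgebra.toSubmodule (spanAlg Γ) ≤ (Subalgebra.toSubmodule (spanAlg Γ)).comap
      (LinearMap.mulLeftRight ℤ_[ℓ] (coePair ℓ t, coePair ℓ t⁻¹)) := spanAlg_le fun x hx => by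
    rw [Submodule.mem_comap, LinearMap.mulLeftRight_apply, ← map_mul, ← map_mul]
    exact coePair_mem_spanAlg (ht x hx)
  exact hle hz

theorem toZMod_trace (g : SL(2, ℤ_[ℓ])) :
    PadicInt.toZMod (g : Mat ℓ).trace = (red ℓ g : Matrix (Fin 2) (Fin 2) (ZMod ℓ)).trace := by
  rw [Matrix.trace_fin_two, Matrix.trace_fin_two, map_add]
  rfl

theorem red_eq_of_dvd_trace_sub (hℓ : 2 < ℓ) {x y : SL(2, ℤ_[ℓ])}
    (h : (ℓ : ℤ_[ℓ]) ∣ (x : Mat ℓ).trace - (y : Mat ℓ).trace)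
    (hx : IsScalar (red ℓ x)) (hy : IsScalar (red ℓ y)) : red ℓ x = red ℓ y := by
  obtain ⟨c, hc⟩ := hx
  obtain ⟨d, hd⟩ := hy
  have htrace : PadicInt.toZMod (x : Mat ℓ).trace = PadicInt.toZMod (y : Mat ℓ).trace := by
    rw [← sub_eq_zero, ← map_sub, ← RingHom.mem_ker, PadicInt.ker_toZMod,
      PadicInt.maximalIdeal_eq_span_p, Ideal.mem_span_singleton]
    exact h
  have hcd : c * 2 = d * 2 := by
    simpa [toZMod_trace, hc, hd, Matrix.trace_smul, Matrix.trace_one] using htrace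
  have h2 : IsUnit (2 : ZMod ℓ) := by
    simpa only [map_ofNat] using (isUnit_two hℓ).map PadicInt.toZMod
  exact Subtype.ext (by rw [hc, hd, h2.mul_right_cancel hcd])

theorem NearlyDiagonal.red_eq (hℓ : 2 < ℓ) {A : Subalgebra ℤ_[ℓ] (MatPair ℓ)} {e m f : ℕ}
    (hA : NearlyDiagonal A e m) (hf : f ≤ e) (hm : m < f) {t : SLpair ℓ}
    (ht : HasSign A m f t 1) (h₁ : IsScalar (red ℓ t.1)) (h₂ : IsScalar (red ℓ t.2)) :
    red ℓ t.1 = red ℓ t.2 := by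
  refine red_eq_of_dvd_trace_sub hℓ ?_ h₁ h₂
  have h := pow_dvd_of_pow_dvd_mul (c := 1) hm (hA.pow_dvd_pow_mul_traceDiff hf ht (one_mem A))
  rwa [pow_one, mul_one] at h

theorem exists_ball₂_le_and_nearlyDiagonal (hℓ : 2 < ℓ) {m : ℕ} (hpos : 0 < m)
    (hΓ : Γ ≤ ball₂ ℓ 1 1) (hopen : IsOpen (Γ : Set (SLpair ℓ)))
    (h₁ : LiftsUnipotents Γ (MonoidHom.fst _ _) ((ℓ : ℤ_[ℓ]) ^ m))
    (h₂ : LiftsUnipotents Γ (MonoidHom.snd _ _) ((ℓ : ℤ_[ℓ]) ^ m)) :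
    ∃ e, ball₂ ℓ (m + (e + m)) (m + (e + m)) ≤ Γ ∧ NearlyDiagonal (spanAlg Γ) e m := by
  have hm₁ : scaledSl ℓ m ≤ (lieAlg ℓ Γ).map (LinearMap.fst ℤ_[ℓ] (Mat ℓ) (Mat ℓ)) :=
    scaledSl_le_map_lieAlg hℓ (p := MonoidHom.fst _ _) (fun _ => rfl) h₁
  have hm₂ : scaledSl ℓ m ≤ (lieAlg ℓ Γ).map (LinearMap.snd ℤ_[ℓ] (Mat ℓ) (Mat ℓ)) :=
    scaledSl_le_map_lieAlg hℓ (p := MonoidHom.snd _ _) (fun _ => rfl) h₂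
  obtain ⟨e, ⟨x, hx, u, hu, he⟩, hmin⟩ := exists_trace_precision hℓ hopen
  exact ⟨e, ball₂_le_of_tau_sub hℓ hΓ hopen hpos hm₁ hm₂ hx hu he,
    nearlyDiagonal_spanAlg hℓ h₁ h₂ hmin⟩

end SpanOfSubgroup

end PinkSL2

theorem mainTheorem2_general (ℓ : ℕ) [Fact ℓ.Prime] (hℓ : 2 < ℓ)
    (G : Subgroup (SL(2, ℤ_[ℓ]) × SL(2, ℤ_[ℓ])))
    (hG : IsOpen (G : Set (SL(2, ℤ_[ℓ]) × SL(2, ℤ_[ℓ])))) (n : ℕ)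
    (hG₁ : PinkSL2.ball ℓ n ≤ G.map (MonoidHom.fst SL(2, ℤ_[ℓ]) SL(2, ℤ_[ℓ])))
    (hG₂ : PinkSL2.ball ℓ n ≤ G.map (MonoidHom.snd SL(2, ℤ_[ℓ]) SL(2, ℤ_[ℓ]))) :
    PinkSL2.ball₂ ℓ (11 * n + 9) (11 * n + 9) ≤ ⁅G, G⁆ ∨
    ∃ T : Subgroup (SL(2, ℤ_[ℓ]) × SL(2, ℤ_[ℓ])),
      T ≤ G ∧ IsOpen (T : Set (SL(2, ℤ_[ℓ]) × SL(2, ℤ_[ℓ]))) ∧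
      T.relIndex G ∣ 2 ∧
      (∀ k : ℕ, (PinkSL2.scaledSl ℓ k).prod (PinkSL2.scaledSl ℓ k) ≤ PinkSL2.lieAlg ℓ T →
        PinkSL2.ball₂ ℓ (4 * k) (4 * k) ≤ ⁅T, T⁆) ∧
      (∀ t ∈ T, PinkSL2.IsScalar (PinkSL2.red ℓ t.1) → PinkSL2.IsScalar (PinkSL2.red ℓ t.2) →
        PinkSL2.red ℓ t.1 = PinkSL2.red ℓ t.2) := by
  open PinkSL2 in
  have hlift₁ := liftsUnipotents_of_ball_le hG₁
  have hlift₂ := liftsUnipotents_of_ball_le hG₂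
  obtain ⟨e, hball, hA⟩ := exists_ball₂_le_and_nearlyDiagonal hℓ n.succ_pos inf_le_right
    (hG.inter (isOpen_ball₂ 1)) (hlift₁.inf_ball₂ hℓ) (hlift₂.inf_ball₂ hℓ)
  rcases le_or_gt (e + 3 * n + 2) (11 * n + 9) with he | he
  · exact Or.inl ((ball₂_anti (by omega)).trans
      (ball₂_le_commutator hℓ (by omega) (hball.trans inf_le_left) hlift₁ hlift₂))
  have hconj (t) (ht : t ∈ G) (x) (hx : x ∈ G ⊓ ball₂ ℓ 1 1) : t * x * t⁻¹ ∈ G ⊓ ball₂ ℓ 1 1 :=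
    ⟨G.mul_mem (G.mul_mem ht hx.1) (G.inv_mem ht), (ball₂_normal 1).conj_mem x hx.2 t⟩
  obtain ⟨T, hindex, hT⟩ := hA.exists_sign_subgroup hℓ (f := e - 4 * (n + 1)) (by omega) (by omega)
    (G := G) fun t ht _ hz => conj_mem_spanAlg (hconj t ht) hz
  have hΓT : G ⊓ ball₂ ℓ 1 1 ≤ T :=
    fun x hx => (hT x).2 ⟨hx.1, hasSign_of_mem (coePair_mem_spanAlg hx)⟩
  have hsign (t) (ht : t ∈ T) := ((hT t).1 ht).2
  refine Or.inr ⟨T, fun t ht => ((hT t).1 ht).1, Subgroup.isOpen_mono hΓT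
    (hG.inter (isOpen_ball₂ 1)), hindex, fun k hk => ?_, fun t ht =>
      hA.red_eq hℓ (by omega) (by omega) (hsign t ht)⟩
  have hek := hA.le_of_scaledSl_le (by omega) hsign hk
  exact (ball₂_anti (by omega)).trans (ball₂_le_commutator hℓ (by omega) (hball.trans hΓT)
    ((hlift₁.inf_ball₂ hℓ).mono hΓT) ((hlift₂.inf_ball₂ hℓ).mono hΓT))

theorem mainTheorem2 (ℓ : ℕ) [Fact ℓ.Prime] (hℓ : 2 < ℓ)
    (G : Subgroup (SL(2, ℤ_[ℓ]) × SL(2, ℤ_[ℓ])))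
    (hG : IsOpen (G : Set (SL(2, ℤ_[ℓ]) × SL(2, ℤ_[ℓ]))))
    (n₁ n₂ : ℕ) (hn₁ : 0 < n₁) (hn₂ : 0 < n₂)
    (hG₁ : PinkSL2.ball ℓ n₁ ≤ G.map (MonoidHom.fst SL(2, ℤ_[ℓ]) SL(2, ℤ_[ℓ])))
    (hG₂ : PinkSL2.ball ℓ n₂ ≤ G.map (MonoidHom.snd SL(2, ℤ_[ℓ]) SL(2, ℤ_[ℓ]))) :
    PinkSL2.ball₂ ℓ (20 * max n₁ n₂) (20 * max n₁ n₂) ≤ ⁅G, G⁆ ∨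
    ∃ T : Subgroup (SL(2, ℤ_[ℓ]) × SL(2, ℤ_[ℓ])),
      T ≤ G ∧ IsOpen (T : Set (SL(2, ℤ_[ℓ]) × SL(2, ℤ_[ℓ]))) ∧
      T.relIndex G ∣ 48 ^ 2 ∧
      (∀ k : ℕ,
        (PinkSL2.scaledSl ℓ k).prod (PinkSL2.scaledSl ℓ k) ≤ PinkSL2.lieAlg ℓ T →
        PinkSL2.ball₂ ℓ (2 * k + max (2 * k) (max (8 * n₁) (8 * n₂)))
          (2 * k + max (2 * k) (max (8 * n₁) (8 * n₂))) ≤ ⁅T, T⁆) ∧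
      (∀ t ∈ T, PinkSL2.IsScalar (PinkSL2.red ℓ t.1) → PinkSL2.IsScalar (PinkSL2.red ℓ t.2) →
        PinkSL2.red ℓ t.1 = PinkSL2.red ℓ t.2) := by
  rcases mainTheorem2_general ℓ hℓ G hG (max n₁ n₂)
    ((PinkSL2.ball_anti (le_max_left n₁ n₂)).trans hG₁)
    ((PinkSL2.ball_anti (le_max_right n₁ n₂)).trans hG₂) with h | ⟨T, hTG, hopen, hindex, hT, hred⟩
  · exact Or.inl ((PinkSL2.ball₂_anti (by omega)).trans h)
  · exact Or.inr ⟨T, hTG, hopen, hindex.trans ⟨1152, by norm_num⟩,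
      fun k hk => (PinkSL2.ball₂_anti (by omega)).trans (hT k hk), hred⟩
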